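/- Let $n\ge 1$, $0<\tau<\beta$, $2\le p<\infty$ and $1\le q<p$. Let $u$ be a solution, with values in $\mathcal S'(\mathbb R^n)$, of the linear Moore–Gibson–Thompson equation $$\tau u_{ttt}+u_{tt}-\Delta u-\beta\Delta u_t=0\quad (x\in\mathbb R^n,\ t>0),\qquad u(0)=u_0,\quad u_t(0)=u_1,\quad u_{tt}(0)=u_2 ,$$ where $u,u_t,u_{tt}$ are continuous in $t\in[0,\infty)$ (weakly in $\mathcal S'$). Put $$\mathbf V=(u_t+\tau u_{tt},\ \nabla(u+\tau u_t),\ \nabla u_t),\qquad \mathbf V_0=(u_1+\tau u_2,\ \nabla(u_0+\tau u_1),\ \nabla u_1).$$ Fix a smooth $\varphi:\mathbb R^n\to[0,1]$ supported in $\{3/4\le|\xi|\le 8/3\}$ with $\sum_{j\in\mathbb Z}\varphi(2^{-j}\xi)=1$ for $\xi\ne0$, let $\dot\Delta_j=\varphi(2^{-j}D)$ be the associated homogeneous dyadic blocks, and let $\dot B^{s}_{2,r}$ be the space of those $f\in\mathcal S'(\mathbb R^n)$ with $f=\sum_{j\in\mathbb Z}\dot\Delta_j f$ in $\mathcal S'$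 and $\|f\|_{\dot B^s_{2,r}}=\big\|\big(2^{js}\|\dot\Delta_jf\|_{L^2}\big)_{j\in\mathbb Z}\big\|_{\ell^r}<\infty$. If $$\mathbf V_0\in \dot B^{n(\frac12-\frac1p)}_{2,1}(\mathbb R^n)\cap\dot B^{-n(\frac1q-\frac12)}_{2,\infty}(\mathbb R^n),$$ then $\mathbf V(t)\in L^p(\mathbb R^n)$ for all $t\ge0$, and $$\|\mathbf V(t)\|_{L^p}\le C\,\Big(\|\mathbf V_0\|_{\dot B^{n(\frac12-\frac1p)}_{2,1}}+\|\mathbf V_0\|_{\dot B^{-n(\frac1q-\frac12)}_{2,\infty}}\Big)(1+t)^{-\frac n2\left(\frac1q-\frac1p\right)}\qquad\text{for all }t\ge0,$$ with a constant $C$ that depends only on $n,\tau,\beta,p,q$ and $\varphi$, and not on $t$ or on the solution. -/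

import Mathlib

open scoped SchwartzMap LineDeriv Laplacian ENNReal

noncomputable section

namespace MGT

/-- The space `ℝⁿ` with its Euclidean norm. -/
abbrev Rn (n : ℕ) := EuclideanSpace ℝ (Fin n)

/-! ### Littlewood-Paley blocks and homogeneous Besov spaces -/

/-- A homogeneous dyadic partition of unity on `ℝⁿ`: a smooth function `φ` with values in `[0, 1]`,
supported in the annulus `3/4 ≤ |ξ| ≤ 8/3`, such that `∑_{j ∈ ℤ} φ (2^{-j} ξ) = 1` for `ξ ≠ 0`. -/
structure DyadicPartition (n : ℕ) where
  /-- the profile of the partition -/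
  φ : Rn n → ℝ
  smooth : ContDiff ℝ ((⊤ : ℕ∞) : WithTop ℕ∞) φ
  mem_Icc : ∀ ξ, φ ξ ∈ Set.Icc (0 : ℝ) 1
  support_subset : Function.support φ ⊆ {ξ | 3 / 4 ≤ ‖ξ‖ ∧ ‖ξ‖ ≤ 8 / 3}
  hasSum_one : ∀ ξ, ξ ≠ 0 → HasSum (fun j : ℤ => φ ((2 : ℝ) ^ (-j) • ξ)) 1

/-- The homogeneous dyadic block `φ (2^{-j} D) f` of a tempered distribution `f`.
`D` refers to the Fourier transform with kernel `e^{-i x·ξ}`. Mathlib's kernel is `e^{-2π i x·ξ}`,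
whence the factor `2π` in the symbol. -/
def block {n : ℕ} (P : DyadicPartition n) (j : ℤ) (f : 𝓢'(Rn n, ℂ)) : 𝓢'(Rn n, ℂ) :=
  TemperedDistribution.fourierMultiplierCLM ℂ
    (fun ξ : Rn n => ((P.φ (((2 : ℝ) ^ (-j) * (2 * Real.pi)) • ξ) : ℝ) : ℂ)) f

/-- The tempered distribution `T` is given by the `L^p` function `g`. -/
def IsRepresentedBy {n : ℕ} (p : ℝ≥0∞) (T : 𝓢'(Rn n, ℂ)) (g : Rn n → ℂ) : Prop :=
  MeasureTheory.MemLp g p MeasureTheory.volume ∧ ∀ ψ : 𝓢(Rn n, ℂ), T ψ = ∫ x, ψ x * g x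

/-- The `L^p` norm (`1 ≤ p ≤ ∞`) of a tempered distribution: the `L^p` norm of the (a.e. unique)
function in `L^p` that represents it, and `∞` if there is none. -/
def lpNorm {n : ℕ} (p : ℝ≥0∞) (T : 𝓢'(Rn n, ℂ)) : ℝ≥0∞ :=
  ⨅ (g : Rn n → ℂ) (_ : IsRepresentedBy p T g), MeasureTheory.eLpNorm g p MeasureTheory.volume

/-- The homogeneous Besov norm `‖f‖_{Ḃ^s_{p,r}}`, with values in `[0, ∞]`. -/
def besovNorm {n : ℕ} (P : DyadicPartition n) (s : ℝ) (p r : ℝ≥0∞) (f : 𝓢'(Rn n, ℂ)) : ℝ≥0∞ :=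
  if r = ∞ then
    ⨆ j : ℤ, ENNReal.ofReal ((2 : ℝ) ^ ((j : ℝ) * s)) * lpNorm p (block P j f)
  else
    (∑' j : ℤ, (ENNReal.ofReal ((2 : ℝ) ^ ((j : ℝ) * s)) * lpNorm p (block P j f)) ^ r.toReal)
      ^ (1 / r.toReal)

/-- `f ∈ Ḃ^s_{p,r}`: the tempered distribution `f` is the sum in `𝓢'` of its homogeneous dyadic
blocks (which excludes nonzero polynomials), and its homogeneous Besov norm is finite. -/
def MemBesov {n : ℕ} (P : DyadicPartition n) (s : ℝ) (p r : ℝ≥0∞) (f : 𝓢'(Rn n, ℂ)) : Prop :=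
  HasSum (fun j : ℤ => block P j f) f ∧ besovNorm P s p r f < ∞

/-! ### The linear Moore-Gibson-Thompson equation -/

/-- `u : [0, ∞) → 𝓢'(ℝⁿ)` is a solution of `τ u_ttt + u_tt - Δ u - β Δ u_t = 0` for `t > 0`,
with initial data `u = u₀`, `u_t = u₁`, `u_tt = u₂` at `t = 0`. Here `ut` and `utt` are the first
two time derivatives of `u`, which are continuous up to `t = 0`. Limits and derivatives in time are
taken in the topology of `𝓢'`, i.e. after pairing with test functions; derivatives in space are
those of tempered distributions. Values at negative times are irrelevant. -/
structure IsSolution {n : ℕ} (τ β : ℝ) (u₀ u₁ u₂ : 𝓢'(Rn n, ℂ))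
    (u ut utt : ℝ → 𝓢'(Rn n, ℂ)) : Prop where
  deriv_u : ∀ t, 0 ≤ t → ∀ ψ : 𝓢(Rn n, ℂ),
    HasDerivWithinAt (fun s => u s ψ) (ut t ψ) (Set.Ici 0) t
  deriv_ut : ∀ t, 0 ≤ t → ∀ ψ : 𝓢(Rn n, ℂ),
    HasDerivWithinAt (fun s => ut s ψ) (utt t ψ) (Set.Ici 0) t
  continuousOn_utt : ∀ ψ : 𝓢(Rn n, ℂ), ContinuousOn (fun s => utt s ψ) (Set.Ici 0)
  equation : ∀ t, 0 < t → ∃ uttt : 𝓢'(Rn n, ℂ),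
    (∀ ψ : 𝓢(Rn n, ℂ), HasDerivAt (fun s => utt s ψ) (uttt ψ) t) ∧
      (τ : ℂ) • uttt + utt t - Δ (u t) - (β : ℂ) • Δ (ut t) = 0
  init_u : u 0 = u₀
  init_ut : ut 0 = u₁
  init_utt : utt 0 = u₂

/-- The `j`-th partial derivative of a tempered distribution. -/
def pderiv {n : ℕ} (j : Fin n) (f : 𝓢'(Rn n, ℂ)) : 𝓢'(Rn n, ℂ) :=
  ∂_{(EuclideanSpace.single j (1 : ℝ) : Rn n)} f

/-- The vector `V = (u_t + τ u_tt, ∇(u + τ u_t), ∇u_t)`, as the family of its `1 + n + n`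
components. -/
def vec {n : ℕ} (τ : ℝ) (u ut utt : 𝓢'(Rn n, ℂ)) : Unit ⊕ Fin n ⊕ Fin n → 𝓢'(Rn n, ℂ)
  | .inl _ => ut + (τ : ℂ) • utt
  | .inr (.inl j) => pderiv j (u + (τ : ℂ) • ut)
  | .inr (.inr j) => pderiv j ut

/-- The `L^p` norm of a vector of tempered distributions: the sum of those of the components. -/
def vecLpNorm {n : ℕ} {ι : Type*} [Fintype ι] (p : ℝ≥0∞) (V : ι → 𝓢'(Rn n, ℂ)) : ℝ≥0∞ :=
  ∑ i, lpNorm p (V i)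

/-- The homogeneous Besov norm of a vector: the sum of those of the components. -/
def vecBesovNorm {n : ℕ} {ι : Type*} [Fintype ι] (P : DyadicPartition n) (s : ℝ) (p r : ℝ≥0∞)
    (V : ι → 𝓢'(Rn n, ℂ)) : ℝ≥0∞ :=
  ∑ i, besovNorm P s p r (V i)

end MGT

end

open scoped SchwartzMap LineDeriv Laplacian ENNReal

noncomputable section

namespace MGT

open scoped ContDiff Topology
open Filter

/-! ### Uniform boundedness and density in the Schwartz space. -/

section SchwartzAux

variable {E : Type*} [NormedAddCommGroup E] [NormedSpace ℝ E]

/-! Write `η = 2πξ`, `κ = β - τ > 0`, and let `(a, b, c)` be the Fourier transform of `V`. The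
equation becomes an ODE in time with matrix symbol `A = symbol τ κ η`. The energy `|a|² + |b|² +
κτ|c|²` dissipates only `c` and the part of `b` orthogonal to `η`. Adding small multiples of the
cross terms `Im(ā η·c)` and `Im(ā η·b)`, weighted by `1/(1 + |η|²)`, spreads the damping to all
components (`system_decay_aux`). Hence `exp(tA)` is bounded by `C exp(-c t |η|²/(1 + |η|²))`:
heat-like decay at low frequency, uniform exponential decay at high frequency.

On the `j`-th annulus the rate is at least a multiple of `4^j/(2 + 4^j)`, and Bernstein's inequality
passes from `L²` to `L^p` at the cost of `2^{jn(1/2-1/p)}` (`exists_fourierInv_of_support`). In the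
sum over `j` (`tsum_weighted_decay_le`), the terms `j ≥ 0` decay exponentially against the `ℓ¹`
Besov norm. The terms `j ≤ 0` are bounded by the `ℓ^∞` Besov norm times `∑ 2^{jα} exp(-c 4^j
(1+t))`, which is `O((1+t)^{-α/2})` with `α = n(1/q - 1/p) > 0`.

Since the solution is only a curve in `𝓢'`, the formula "transform of `V(t)` equals `exp(tA)` times
that of `V₀`" has to be justified. Tested against a compactly supported `ψ`, the time derivatives
are pairings with the functions `A^m ψ`, whose seminorms grow geometrically in `m`. Uniform
boundedness then makes the Taylor remainder vanish (`hasSum_evolution`). Interchanging the Taylor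
series with the dyadic sum of the data gives the exponential block by block
(`hasSum_integral_exp_mulVec`), and the resulting series converges in `L^p` to `V(t)`
(`lpNorm_le_tsum`). -/

lemma summable_norm_lp_one (c : lp (fun _ : ℕ => ℂ) 1) : Summable fun m => ‖c m‖ := by
  have h := (memℓp_gen_iff (p := 1) (by simp)).1 (lp.memℓp c)
  simpa using h

lemma lp_one_norm_eq (c : lp (fun _ : ℕ => ℂ) 1) : ‖c‖ = ∑' m, ‖c m‖ := by
  have h := lp.norm_eq_tsum_rpow (p := 1) (by simp) c
  simpa using h

/-- A bounded sequence in the Schwartz space defines a continuous linear map `ℓ¹ → 𝓢`. -/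
lemma exists_lp_one_map (ψ : ℕ → 𝓢(E, ℂ))
    (hψ : ∀ k l : ℕ, ∃ C, ∀ m, SchwartzMap.seminorm ℂ k l (ψ m) ≤ C) :
    ∃ L : lp (fun _ : ℕ => ℂ) 1 →L[ℂ] 𝓢(E, ℂ), ∀ m, L (lp.single 1 m 1) = ψ m := by
  choose C hC using hψ
  have hC0 : ∀ k l, 0 ≤ C k l := fun k l => (apply_nonneg _ _).trans (hC k l 0)
  have hbd : ∀ (c : lp (fun _ : ℕ => ℂ) 1) k l m x,
      ‖x‖ ^ k * ‖iteratedFDeriv ℝ l (fun y => c m * ψ m y) x‖ ≤ ‖c m‖ * C k l := by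
    intro c k l m x
    have h1 : iteratedFDeriv ℝ l (fun y => c m * ψ m y) x = c m • iteratedFDeriv ℝ l (ψ m) x := by
      have := iteratedFDeriv_const_smul_apply (𝕜 := ℝ) (i := l) (a := c m)
        (f := ψ m) (x := x) ((ψ m).contDiffAt l)
      simpa [Pi.smul_def] using this
    rw [h1, norm_smul, mul_left_comm]
    exact mul_le_mul_of_nonneg_left (((ψ m).le_seminorm ℂ k l x).trans (hC k l m)) (norm_nonneg _)
  have hbd0 : ∀ (c : lp (fun _ : ℕ => ℂ) 1) l m x,
      ‖iteratedFDeriv ℝ l (fun y => c m * ψ m y) x‖ ≤ ‖c m‖ * C 0 l := fun c l m x => by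
    simpa using hbd c 0 l m x
  have hs : ∀ (c : lp (fun _ : ℕ => ℂ) 1) k l, Summable fun m => ‖c m‖ * C k l := fun c k l =>
    (summable_norm_lp_one c).mul_right _
  have hsm : ∀ (c : lp (fun _ : ℕ => ℂ) 1) m, ContDiff ℝ ∞ fun y => c m * ψ m y := fun c m =>
    contDiff_const.mul ((ψ m).smooth ⊤)
  have hbound : ∀ (c : lp (fun _ : ℕ => ℂ) 1) k l x,
      ‖x‖ ^ k * ‖iteratedFDeriv ℝ l (fun y => ∑' m, c m * ψ m y) x‖ ≤ C k l * ‖c‖ := by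
    intro c k l x
    rw [iteratedFDeriv_tsum_apply (N := ⊤) (v := fun l m => ‖c m‖ * C 0 l) (hsm c)
      (fun l _ => hs c 0 l) (fun l m x _ => hbd0 c l m x) (by simp) x, lp_one_norm_eq,
      mul_comm (C k l), ← tsum_mul_right]
    have hsn : Summable fun m => ‖iteratedFDeriv ℝ l (fun y => c m * ψ m y) x‖ :=
      Summable.of_nonneg_of_le (fun _ => norm_nonneg _) (fun m => hbd0 c l m x) (hs c 0 l)
    calc _ ≤ ‖x‖ ^ k * ∑' m, ‖iteratedFDeriv ℝ l (fun y => c m * ψ m y) x‖ := by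
          gcongr
          exact norm_tsum_le_tsum_norm hsn
      _ = ∑' m, ‖x‖ ^ k * ‖iteratedFDeriv ℝ l (fun y => c m * ψ m y) x‖ := tsum_mul_left.symm
      _ ≤ _ := (hsn.mul_left _).tsum_le_tsum (fun m => hbd c k l m x) (hs c k l)
  have hsx : ∀ (c : lp (fun _ : ℕ => ℂ) 1) x, Summable fun m => c m * ψ m x := fun c x => by
    refine Summable.of_norm (Summable.of_nonneg_of_le (fun _ => norm_nonneg _) (fun m => ?_)
      (hs c 0 0))
    simpa using hbd c 0 0 m x
  let L₀ : lp (fun _ : ℕ => ℂ) 1 →ₗ[ℂ] 𝓢(E, ℂ) :=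
    { toFun := fun c => ⟨fun y => ∑' m, c m * ψ m y,
        contDiff_tsum (N := ⊤) (v := fun l m => ‖c m‖ * C 0 l) (hsm c)
          (fun l _ => hs c 0 l) (fun l m x _ => hbd0 c l m x),
        fun k l => ⟨_, hbound c k l⟩⟩
      map_add' := fun c d => by
        ext x
        change ∑' m, (c m + d m) * ψ m x = ∑' m, c m * ψ m x + ∑' m, d m * ψ m x
        rw [← (hsx c x).tsum_add (hsx d x)]
        simp_rw [add_mul]
      map_smul' := fun a c => by
        ext x
        change ∑' m, (a * c m) * ψ m x = a * ∑' m, c m * ψ m x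
        rw [← tsum_mul_left]
        simp_rw [mul_assoc] }
  have hcont : Continuous L₀ := by
    refine WithSeminorms.continuous_normedSpace_dom _ (schwartz_withSeminorms ℂ E ℂ) L₀ ?_
    rintro ⟨k, l⟩
    refine ⟨⟨C k l, hC0 k l⟩, fun c => ?_⟩
    exact SchwartzMap.seminorm_le_bound ℂ k l _ (mul_nonneg (hC0 k l) (norm_nonneg c))
      (hbound c k l)
  refine ⟨⟨L₀, hcont⟩, fun m => ?_⟩
  ext x
  change ∑' k, (lp.single 1 m (1 : ℂ) : lp (fun _ : ℕ => ℂ) 1) k * ψ k x = ψ m x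
  rw [tsum_eq_single m]
  · simp
  · intro k hk
    simp [Pi.single_eq_of_ne hk]

/-- A pointwise bounded family of tempered distributions is uniformly bounded on every bounded
sequence of Schwartz functions. -/
lemma exists_uniform_bound {α : Type*} (T : α → 𝓢'(E, ℂ))
    (hT : ∀ f, ∃ C, ∀ a, ‖T a f‖ ≤ C) (ψ : ℕ → 𝓢(E, ℂ))
    (hψ : ∀ k l : ℕ, ∃ C, ∀ m, SchwartzMap.seminorm ℂ k l (ψ m) ≤ C) :
    ∃ C, ∀ a m, ‖T a (ψ m)‖ ≤ C := by
  obtain ⟨L, hL⟩ := exists_lp_one_map ψ hψ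
  -- Composing with `L` moves the family to the Banach space `ℓ¹`, where Banach–Steinhaus applies.
  -- The unit vectors have norm one, so the operator bound is uniform in `m`.
  let g : α → (lp (fun _ : ℕ => ℂ) 1 →L[ℂ] ℂ) := fun a =>
    ⟨(T a).toLinearMap ∘ₗ L.toLinearMap, (T a).continuous.comp L.continuous⟩
  obtain ⟨C, hC⟩ := banach_steinhaus (g := g) (fun c => hT (L c))
  refine ⟨C, fun a m => ?_⟩
  have h1 : ‖g a (lp.single 1 m 1)‖ ≤ ‖g a‖ * ‖(lp.single 1 m (1 : ℂ) : lp (fun _ : ℕ => ℂ) 1)‖ :=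
    (g a).le_opNorm _
  have h2 : g a (lp.single 1 m 1) = T a (ψ m) := by
    change T a (L _) = _
    rw [hL]
  rw [h2, lp.norm_single (by simp)] at h1
  simpa using h1.trans (by simpa using hC a)

/-- A tempered distribution that vanishes on compactly supported functions is zero. -/
lemma eq_zero_of_forall_compactSupport [FiniteDimensional ℝ E] (T : 𝓢'(E, ℂ))
    (hT : ∀ ψ : 𝓢(E, ℂ), HasCompactSupport ψ → T ψ = 0) : T = 0 := by
  ext ψ
  let b : ContDiffBump (0 : E) := ⟨1, 2, one_pos, one_lt_two⟩
  have hbs : ContDiff ℝ ∞ fun x : E => ((b x : ℝ) : ℂ) :=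
    Complex.ofRealCLM.contDiff.comp b.contDiff
  have hbc : HasCompactSupport fun x : E => ((b x : ℝ) : ℂ) :=
    b.hasCompactSupport.comp_left (g := fun r : ℝ => (r : ℂ)) (by simp)
  let χ : 𝓢(E, ℂ) := hbc.toSchwartzMap hbs
  let η : ℕ → E → ℂ := fun N x => χ (((N : ℝ) + 1)⁻¹ • x)
  have hpos : ∀ N : ℕ, (0 : ℝ) < (N : ℝ) + 1 := fun N => by positivity
  have hηs : ∀ N, ContDiff ℝ ∞ (η N) := fun N => (χ.smooth ⊤).comp (contDiff_const_smul _)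
  have hηc : ∀ N, HasCompactSupport (η N) := fun N =>
    HasCompactSupport.comp_smul hbc (inv_ne_zero (hpos N).ne')
  have hη1 : ∀ (N : ℕ) x, ‖x‖ ≤ (N : ℝ) + 1 → η N x = 1 := by
    intro N x hx
    change ((b (((N : ℝ) + 1)⁻¹ • x) : ℝ) : ℂ) = 1
    rw [b.one_of_mem_closedBall, Complex.ofReal_one]
    rw [mem_closedBall_zero_iff, norm_smul, norm_inv, Real.norm_of_nonneg (hpos N).le,
      inv_mul_le_iff₀ (hpos N)]
    simpa [b] using hx
  let ψN : ℕ → 𝓢(E, ℂ) := fun N => ((hηc N).mul_right (f' := ψ)).toSchwartzMap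
    ((hηs N).mul (ψ.smooth ⊤))
  have hψN : ∀ N x, ψN N x = η N x * ψ x := fun N x => rfl
  have hzero : ∀ N, T (ψN N) = 0 := fun N => hT _ (hηc N).mul_right
  have hlim : Tendsto ψN atTop (𝓝 ψ) := by
    rw [(schwartz_withSeminorms ℂ E ℂ).tendsto_nhds _ _]
    rintro ⟨k, l⟩ ε hε
    choose D hD0 hD using fun s => χ.decay 0 s
    -- The extra power of `‖x‖` supplies the convergence: `η N - 1` vanishes for `‖x‖ < N + 1`, and
    -- beyond that radius one power of `‖x‖` is worth a factor `1/(N + 1)`.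
    obtain ⟨K, hK⟩ : ∃ K, ∀ s x, s ≤ l → ‖x‖ ^ (k + 1) * ‖iteratedFDeriv ℝ s ψ x‖ ≤ K := by
      choose K hK0 hK using fun s => ψ.decay (k + 1) s
      refine ⟨∑ s ∈ Finset.range (l + 1), K s, fun s x hs => (hK s x).trans ?_⟩
      exact Finset.single_le_sum (f := K) (fun i _ => (hK0 i).le) (by simp; omega)
    have hK0 : 0 ≤ K := le_trans (by positivity) (hK 0 0 (Nat.zero_le _))
    let M : ℝ := ∑ i ∈ Finset.range (l + 1), (l.choose i : ℝ) * (1 + D i) * K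
    have hM0 : 0 ≤ M := Finset.sum_nonneg fun i _ => by have := hD0 i; positivity
    have key : ∀ N, SchwartzMap.seminorm ℂ k l (ψN N - ψ) ≤ M / ((N : ℝ) + 1) := by
      intro N
      refine SchwartzMap.seminorm_le_bound ℂ k l _ (div_nonneg hM0 (hpos N).le) fun x => ?_
      have hfun : ((ψN N - ψ : 𝓢(E, ℂ)) : E → ℂ) = fun y => (η N y - 1) * ψ y := by
        ext y
        simp [hψN, sub_mul]
      by_cases hx : ‖x‖ < (N : ℝ) + 1
      · have : iteratedFDeriv ℝ l (⇑(ψN N - ψ)) x = 0 := by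
          have hev : (⇑(ψN N - ψ)) =ᶠ[𝓝 x] fun _ => (0 : ℂ) := by
            filter_upwards [(isOpen_lt continuous_norm continuous_const).mem_nhds hx] with y hy
            rw [hfun]
            simp [hη1 N y (le_of_lt hy)]
          rw [hev.iteratedFDeriv ℝ l |>.eq_of_nhds]
          simp
        rw [this]
        simp only [norm_zero, mul_zero]
        exact div_nonneg hM0 (hpos N).le
      · push Not at hx
        have hx0 : 0 < ‖x‖ := (hpos N).trans_le hx
        have hηd : ∀ i, ‖iteratedFDeriv ℝ i (fun y => η N y - 1) x‖ ≤ 1 + D i := by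
          intro i
          have h0 : iteratedFDeriv ℝ i (η N) x =
              (((N : ℝ) + 1)⁻¹) ^ i • iteratedFDeriv ℝ i χ (((N : ℝ) + 1)⁻¹ • x) := by
            have := iteratedFDeriv_comp_const_smul (𝕜 := ℝ) (i := i) (f := χ) (((N : ℝ) + 1)⁻¹)
              (χ.smooth i)
            exact congrFun this x
          have h1 : ‖iteratedFDeriv ℝ i (η N) x‖ ≤ D i := by
            rw [h0, norm_smul]
            calc _ ≤ 1 * D i := by
                  gcongr
                  · rw [norm_pow, norm_inv, Real.norm_of_nonneg (hpos N).le]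
                    refine pow_le_one₀ (by positivity) (inv_le_one_of_one_le₀ ?_)
                    linarith [(Nat.cast_nonneg N : (0 : ℝ) ≤ N)]
                  · simpa using hD i (((N : ℝ) + 1)⁻¹ • x)
              _ = D i := one_mul _
          have h2 : ‖iteratedFDeriv ℝ i (fun _ : E => (1 : ℂ)) x‖ ≤ 1 := by
            rcases Nat.eq_zero_or_pos i with rfl | hi
            · simp
            · rw [iteratedFDeriv_const_of_ne hi.ne']
              simp
          have h3 := iteratedFDeriv_sub_apply (𝕜 := ℝ) (i := i) (x := x) (f := η N)
            (g := fun _ : E => (1 : ℂ)) ((hηs N).of_le (by exact_mod_cast le_top)).contDiffAt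
            contDiff_const.contDiffAt
          have h4 : (η N - fun _ : E => (1 : ℂ)) = fun y => η N y - 1 := rfl
          rw [h4] at h3
          rw [h3]
          linarith [norm_sub_le (iteratedFDeriv ℝ i (η N) x)
            (iteratedFDeriv ℝ i (fun _ : E => (1 : ℂ)) x)]
        have hmul := norm_iteratedFDeriv_mul_le (𝕜 := ℝ) (N := ∞) (n := l)
          ((hηs N).sub contDiff_const (g := fun _ => (1 : ℂ))) (ψ.smooth ⊤) x
          (by exact_mod_cast le_top)
        rw [hfun]
        have h5 : ∀ s, s ≤ l → ‖x‖ ^ k * ‖iteratedFDeriv ℝ s ψ x‖ ≤ K / ((N : ℝ) + 1) := by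
          intro s hs
          rw [le_div_iff₀ (hpos N)]
          calc _ ≤ ‖x‖ ^ k * ‖iteratedFDeriv ℝ s ψ x‖ * ‖x‖ := by gcongr
            _ = ‖x‖ ^ (k + 1) * ‖iteratedFDeriv ℝ s ψ x‖ := by ring
            _ ≤ K := hK s x hs
        calc _ ≤ ‖x‖ ^ k * ∑ i ∈ Finset.range (l + 1), (l.choose i : ℝ) *
                ‖iteratedFDeriv ℝ i (fun y => η N y - 1) x‖ * ‖iteratedFDeriv ℝ (l - i) ψ x‖ := by
              gcongr
          _ = ∑ i ∈ Finset.range (l + 1), (l.choose i : ℝ) *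
                ‖iteratedFDeriv ℝ i (fun y => η N y - 1) x‖ *
                  (‖x‖ ^ k * ‖iteratedFDeriv ℝ (l - i) ψ x‖) := by
              rw [Finset.mul_sum]
              exact Finset.sum_congr rfl fun i _ => by ring
          _ ≤ ∑ i ∈ Finset.range (l + 1), (l.choose i : ℝ) * (1 + D i) * (K / ((N : ℝ) + 1)) := by
              refine Finset.sum_le_sum fun i _ => ?_
              have := hD0 i
              exact mul_le_mul (mul_le_mul_of_nonneg_left (hηd i) (Nat.cast_nonneg _))
                (h5 _ (Nat.sub_le _ _)) (by positivity) (by positivity)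
          _ = M / ((N : ℝ) + 1) := by
              simp only [M, Finset.sum_div, mul_div_assoc]
    have h0 : Tendsto (fun N : ℕ => M / ((N : ℝ) + 1)) atTop (𝓝 0) :=
      tendsto_const_nhds.div_atTop (tendsto_natCast_atTop_atTop.atTop_add tendsto_const_nhds)
    filter_upwards [h0.eventually_lt_const hε] with N hN
    exact (key N).trans_lt hN
  have h1 : Tendsto (fun N => T (ψN N)) atTop (𝓝 (T ψ)) := (T.continuous.tendsto ψ).comp hlim
  simp_rw [hzero] at h1
  exact (tendsto_nhds_unique tendsto_const_nhds h1).symm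

end SchwartzAux

end MGT

/-! ### Taylor expansion in time of a linear system in `𝓢'`. -/

namespace MGT

open scoped ContDiff Topology
open Filter

/-- Taylor's formula for a chain of one-sided derivatives `f 0, f 1, …`. The induction applies the
estimate to the shifted chain and integrates it by the mean value inequality. -/
lemma norm_sub_taylor_le (T M : ℝ) (k : ℕ) : ∀ f : ℕ → ℝ → ℂ,
    (∀ m t, 0 ≤ t → HasDerivWithinAt (f m) (f (m + 1) t) (Set.Ici 0) t) →
    (∀ t ∈ Set.Icc 0 T, ‖f k t‖ ≤ M) → ∀ t ∈ Set.Icc 0 T,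
    ‖f 0 t - ∑ m ∈ Finset.range k, ((t : ℂ) ^ m / m.factorial) * f m 0‖ ≤
      M * (t ^ k / k.factorial) := by
  induction k with
  | zero => intro f _ hM t ht; simpa using hM t ht
  | succ k ih =>
    intro f hf hM t ht
    have ih' := ih (fun m => f (m + 1)) (fun m t ht => hf (m + 1) t ht) hM
    let P : ℝ → ℂ := fun t => ∑ m ∈ Finset.range (k + 1), ((t : ℂ) ^ m / m.factorial) * f m 0
    have hP : ∀ t : ℝ, HasDerivAt P
        (∑ m ∈ Finset.range k, ((t : ℂ) ^ m / m.factorial) * f (m + 1) 0) t := by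
      intro t
      have h1 : ∀ m ∈ Finset.range k, HasDerivAt
          (fun t : ℝ => ((t : ℂ) ^ (m + 1) / (m + 1).factorial) * f (m + 1) 0)
          (((t : ℂ) ^ m / m.factorial) * f (m + 1) 0) t := by
        intro m _
        have h2 := (((hasDerivAt_id (t : ℂ)).comp_ofReal.fun_pow (m + 1)).div_const
          ((m + 1).factorial : ℂ)).mul_const (f (m + 1) 0)
        refine h2.congr_deriv ?_
        simp only [id, Nat.factorial_succ, Nat.cast_mul, Nat.cast_add, Nat.cast_one,
          Nat.add_sub_cancel, mul_one]
        have h3 : (m.factorial : ℂ) ≠ 0 := by exact_mod_cast m.factorial_ne_zero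
        have h4 : ((m : ℂ) + 1) ≠ 0 := by exact_mod_cast m.succ_ne_zero
        field_simp
      have h5 := (HasDerivAt.fun_sum h1).add_const (f 0 0)
      have h6 : P = fun s : ℝ => ∑ m ∈ Finset.range k,
          ((s : ℂ) ^ (m + 1) / (m + 1).factorial) * f (m + 1) 0 + f 0 0 := by
        ext s
        simp [P, Finset.sum_range_succ']
      rw [h6]
      exact h5
    have hd : ∀ s, 0 ≤ s → HasDerivWithinAt (fun s => f 0 s - P s)
        (f 1 s - ∑ m ∈ Finset.range k, ((s : ℂ) ^ m / m.factorial) * f (m + 1) 0)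
        (Set.Ici 0) s := fun s hs => (hf 0 s hs).sub (hP s).hasDerivWithinAt
    refine image_norm_le_of_norm_deriv_right_le_deriv_boundary
      (f := fun s => f 0 s - P s) (a := 0) (b := T)
      (f' := fun s => f 1 s - ∑ m ∈ Finset.range k, ((s : ℂ) ^ m / m.factorial) * f (m + 1) 0)
      (B := fun s => M * (s ^ (k + 1) / (k + 1).factorial))
      (B' := fun s => M * (s ^ k / k.factorial)) ?_ ?_ ?_ ?_ ?_ ht
    · intro s hs
      exact ((hd s hs.1).continuousWithinAt).mono Set.Icc_subset_Ici_self
    · intro s hs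
      exact (hd s hs.1).mono (Set.Ici_subset_Ici.2 hs.1)
    · simp [P, Finset.sum_range_succ']
    · intro s
      have h2 := ((((hasDerivAt_id s).fun_pow (k + 1)).div_const
          ((k + 1).factorial : ℝ)).const_mul M)
      refine h2.congr_deriv ?_
      simp only [id, Nat.factorial_succ, Nat.cast_mul, Nat.cast_add, Nat.cast_one,
        Nat.add_sub_cancel, mul_one]
      have h3 : (k.factorial : ℝ) ≠ 0 := by exact_mod_cast k.factorial_ne_zero
      have h4 : ((k : ℝ) + 1) ≠ 0 := by positivity
      field_simp
    · intro s hs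
      exact ih' s ⟨hs.1, hs.2.le⟩

section Evolution

variable {E : Type*} [NormedAddCommGroup E] [NormedSpace ℝ E]
variable {ι : Type*} [Fintype ι] [DecidableEq ι]

lemma hasTemperateGrowth_matrix_pow {A : E → Matrix ι ι ℂ}
    (hA : ∀ i j, (fun ξ => A ξ i j).HasTemperateGrowth) (m : ℕ) (i j : ι) :
    (fun ξ => (A ξ ^ m) i j).HasTemperateGrowth := by
  induction m generalizing i j with
  | zero => simp [Function.HasTemperateGrowth.const]
  | succ m ih =>
    simp only [pow_succ, Matrix.mul_apply]
    exact Function.HasTemperateGrowth.sum fun k _ => (ih i k).mul (hA k j)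

/-- With the order of differentiation capped at `l`, Leibniz' rule charges each further factor `A`
at most `2^l` times the bound on the derivatives of its entries, and the matrix product charges the
number of indices. So the growth in `m` is only geometric, which `m!` will beat. -/
lemma exists_norm_iteratedFDeriv_matrix_pow_le {A : E → Matrix ι ι ℂ}
    (hA : ∀ i j, (fun ξ => A ξ i j).HasTemperateGrowth) {K : Set E} (hK : IsCompact K) (l : ℕ) :
    ∃ B : ℝ, 0 ≤ B ∧ ∀ m s i j, s ≤ l → ∀ x ∈ K,
      ‖iteratedFDeriv ℝ s (fun ξ => (A ξ ^ m) i j) x‖ ≤ B ^ m := by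
  have h1 : ∀ s i j, ∃ C, ∀ x ∈ K, ‖iteratedFDeriv ℝ s (fun ξ => A ξ i j) x‖ ≤ C := fun s i j =>
    hK.exists_bound_of_continuousOn
      (((hA i j).1.continuous_iteratedFDeriv (by exact_mod_cast le_top)).continuousOn)
  choose C hC using h1
  let B₀ : ℝ := ∑ s ∈ Finset.range (l + 1), ∑ i, ∑ j, |C s i j|
  have hB₀ : 0 ≤ B₀ := by positivity
  have hCB : ∀ s i j, s ≤ l → C s i j ≤ B₀ := by
    intro s i j hs
    refine (le_abs_self _).trans ?_
    refine (Finset.single_le_sum (f := fun j => |C s i j|) (fun _ _ => abs_nonneg _)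
      (Finset.mem_univ j)).trans ?_
    refine (Finset.single_le_sum (f := fun i => ∑ j, |C s i j|) (fun _ _ => by positivity)
      (Finset.mem_univ i)).trans ?_
    exact Finset.single_le_sum (f := fun s => ∑ i, ∑ j, |C s i j|) (fun _ _ => by positivity)
      (by simp; omega)
  refine ⟨Fintype.card ι * (2 ^ l * B₀), by positivity, fun m => ?_⟩
  have hsm := hasTemperateGrowth_matrix_pow hA
  induction m with
  | zero =>
    intro s i j hs x hx
    simp only [pow_zero]
    rcases Nat.eq_zero_or_pos s with rfl | hs
    · simp only [norm_iteratedFDeriv_zero, Matrix.one_apply]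
      split_ifs <;> simp
    · rw [iteratedFDeriv_const_of_ne hs.ne']
      simp
  | succ m ih =>
    intro s i j hs x hx
    simp only [pow_succ, Matrix.mul_apply]
    rw [iteratedFDeriv_sum (f := fun k ξ => (A ξ ^ m) i k * A ξ k j) (fun k _ =>
      (((hsm m i k).mul (hA k j)).1.of_le (by exact_mod_cast le_top)))]
    have hterm : ∀ k, ‖iteratedFDeriv ℝ s (fun ξ => (A ξ ^ m) i k * A ξ k j) x‖ ≤
        (Fintype.card ι * (2 ^ l * B₀)) ^ m * (2 ^ l * B₀) := by
      intro k
      refine (norm_iteratedFDeriv_mul_le (N := ∞) (hsm m i k).1 (hA k j).1 x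
        (by exact_mod_cast le_top)).trans ?_
      calc _ ≤ ∑ r ∈ Finset.range (s + 1), (s.choose r : ℝ) *
              (Fintype.card ι * (2 ^ l * B₀)) ^ m * B₀ := by
            refine Finset.sum_le_sum fun r hr => ?_
            have hr' : r ≤ s := by simpa [Nat.lt_succ_iff] using hr
            gcongr
            · exact ih r i k (hr'.trans hs) x hx
            · exact (hC _ _ _ x hx).trans (hCB _ _ _ ((Nat.sub_le _ _).trans hs))
        _ = 2 ^ s * ((Fintype.card ι * (2 ^ l * B₀)) ^ m * B₀) := by
            simp_rw [mul_assoc]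
            rw [← Finset.sum_mul]
            congr 1
            exact_mod_cast Nat.sum_range_choose s
        _ ≤ 2 ^ l * ((Fintype.card ι * (2 ^ l * B₀)) ^ m * B₀) := by
            gcongr
            exact one_le_two
        _ = _ := by ring
    rw [Finset.sum_apply]
    refine (norm_sum_le_of_le _ fun k _ => hterm k).trans (le_of_eq ?_)
    rw [Finset.sum_const, Finset.card_univ, nsmul_eq_mul]
    ring

lemma exists_seminorm_matrix_pow_le {A : E → Matrix ι ι ℂ}
    (hA : ∀ i j, (fun ξ => A ξ i j).HasTemperateGrowth) (ψ : 𝓢(E, ℂ)) (hψ : HasCompactSupport ψ)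
    (k l : ℕ) :
    ∃ B C : ℝ, 0 ≤ B ∧ 0 ≤ C ∧ ∀ m i j, SchwartzMap.seminorm ℂ k l
      (SchwartzMap.smulLeftCLM ℂ (fun ξ => (A ξ ^ m) i j) ψ) ≤ C * B ^ m := by
  obtain ⟨B, hB0, hB⟩ := exists_norm_iteratedFDeriv_matrix_pow_le hA hψ l
  choose D hD0 hD using fun s => ψ.decay k s
  let C : ℝ := ∑ s ∈ Finset.range (l + 1), (l.choose s : ℝ) * D (l - s)
  have hC0 : 0 ≤ C := Finset.sum_nonneg fun s _ => by have := hD0 (l - s); positivity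
  refine ⟨B, C, hB0, hC0, fun m i j => ?_⟩
  have hm := hasTemperateGrowth_matrix_pow hA m i j
  refine SchwartzMap.seminorm_le_bound ℂ k l _ (by positivity) fun x => ?_
  have hfun : (SchwartzMap.smulLeftCLM ℂ (fun ξ => (A ξ ^ m) i j) ψ : E → ℂ) =
      fun ξ => (A ξ ^ m) i j * ψ ξ := by
    ext ξ
    rw [SchwartzMap.smulLeftCLM_apply_apply hm, smul_eq_mul]
  by_cases hx : x ∈ tsupport ψ
  · rw [hfun]
    calc _ ≤ ‖x‖ ^ k * ∑ s ∈ Finset.range (l + 1), (l.choose s : ℝ) *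
            ‖iteratedFDeriv ℝ s (fun ξ => (A ξ ^ m) i j) x‖ * ‖iteratedFDeriv ℝ (l - s) ψ x‖ := by
          gcongr
          exact norm_iteratedFDeriv_mul_le (N := ∞) hm.1 (ψ.smooth ⊤) x (by exact_mod_cast le_top)
      _ = ∑ s ∈ Finset.range (l + 1), (l.choose s : ℝ) *
            ‖iteratedFDeriv ℝ s (fun ξ => (A ξ ^ m) i j) x‖ *
              (‖x‖ ^ k * ‖iteratedFDeriv ℝ (l - s) ψ x‖) := by
          rw [Finset.mul_sum]
          exact Finset.sum_congr rfl fun i _ => by ring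
      _ ≤ ∑ s ∈ Finset.range (l + 1), (l.choose s : ℝ) * B ^ m * D (l - s) := by
          refine Finset.sum_le_sum fun s hs => ?_
          have hs' : s ≤ l := by simpa [Nat.lt_succ_iff] using hs
          exact mul_le_mul (mul_le_mul_of_nonneg_left (hB m s i j hs' x hx) (Nat.cast_nonneg _))
            (hD _ x) (by positivity) (by positivity)
      _ = C * B ^ m := by
          simp only [C, Finset.sum_mul]
          exact Finset.sum_congr rfl fun i _ => by ring
  · have h0 : iteratedFDeriv ℝ l
        (SchwartzMap.smulLeftCLM ℂ (fun ξ => (A ξ ^ m) i j) ψ : E → ℂ) x = 0 := by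
      by_contra h
      have h1 : x ∈ tsupport (SchwartzMap.smulLeftCLM ℂ (fun ξ => (A ξ ^ m) i j) ψ : E → ℂ) :=
        support_iteratedFDeriv_subset (𝕜 := ℝ) l h
      rw [hfun] at h1
      exact hx (tsupport_mul_subset_right h1)
    rw [h0]
    simp only [norm_zero, mul_zero]
    positivity

/-- The solution of a linear system with symbol `A`, tested against a compactly supported function,
is the sum of its Taylor series in time. -/
lemma hasSum_evolution {A : E → Matrix ι ι ℂ}
    (hA : ∀ i j, (fun ξ => A ξ i j).HasTemperateGrowth) (Z : ℝ → ι → 𝓢'(E, ℂ))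
    (hZ : ∀ t, 0 ≤ t → ∀ i (ψ : 𝓢(E, ℂ)), HasDerivWithinAt (fun s => Z s i ψ)
      (∑ j, Z t j (SchwartzMap.smulLeftCLM ℂ (fun ξ => A ξ i j) ψ)) (Set.Ici 0) t)
    (ψ : 𝓢(E, ℂ)) (hψ : HasCompactSupport ψ) (i : ι) (t : ℝ) (ht : 0 ≤ t) :
    HasSum (fun m : ℕ => ((t : ℂ) ^ m / m.factorial) *
      ∑ j, Z 0 j (SchwartzMap.smulLeftCLM ℂ (fun ξ => (A ξ ^ m) i j) ψ)) (Z t i ψ) := by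
  have hpow := hasTemperateGrowth_matrix_pow hA
  let f : ℕ → ℝ → ℂ := fun m s =>
    ∑ j, Z s j (SchwartzMap.smulLeftCLM ℂ (fun ξ => (A ξ ^ m) i j) ψ)
  have hf : ∀ m t, 0 ≤ t → HasDerivWithinAt (f m) (f (m + 1) t) (Set.Ici 0) t := by
    intro m t ht
    have h1 := HasDerivWithinAt.fun_sum (u := Finset.univ) (fun j _ =>
      hZ t ht j (SchwartzMap.smulLeftCLM ℂ (fun ξ => (A ξ ^ m) i j) ψ))
    refine h1.congr_deriv ?_
    rw [Finset.sum_comm]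
    refine Finset.sum_congr rfl fun k _ => ?_
    rw [← map_sum]
    congr 1
    ext ξ
    rw [SchwartzMap.smulLeftCLM_apply_apply (hpow _ _ _), sum_apply]
    simp_rw [SchwartzMap.smulLeftCLM_apply_apply (hA _ _),
      SchwartzMap.smulLeftCLM_apply_apply (hpow _ _ _), pow_succ, Matrix.mul_apply, smul_eq_mul,
      Finset.sum_mul]
    exact Finset.sum_congr rfl fun j _ => by ring
  have hf0 : ∀ s, f 0 s = Z s i ψ := by
    intro s
    simp only [f, pow_zero]
    rw [Finset.sum_eq_single i]
    · congr 1
      ext ξ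
      have := hpow 0 i i
      simp only [pow_zero] at this
      rw [SchwartzMap.smulLeftCLM_apply_apply this]
      simp
    · intro j _ hj
      have h0 : SchwartzMap.smulLeftCLM ℂ (fun ξ => (1 : Matrix ι ι ℂ) i j) ψ = 0 := by
        ext ξ
        rw [SchwartzMap.smulLeftCLM_apply_apply (Function.HasTemperateGrowth.const _)]
        simp [hj.symm]
      rw [h0, map_zero]
    · simp
  -- The functions `(2t+1)^m / m! • A^m ψ` are bounded in every seminorm, because `m!` beats each
  -- geometric ratio; the ratio may depend on the seminorm. The base `2t + 1` is positive even at `t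
  -- = 0` and gives `t/(2t+1) ≤ 1/2`, so the remainder is at most `C 2^{-k}`.
  have hbound : ∃ C, ∀ m, ∀ s ∈ Set.Icc 0 t,
      ‖f m s‖ ≤ C * (m.factorial / (2 * t + 1) ^ m) := by
    have h1 : ∀ j, ∃ C, ∀ (s : Set.Icc (0 : ℝ) t) (m : ℕ),
        ‖Z s j ((((2 * t + 1) ^ m / m.factorial : ℝ) : ℂ) •
          SchwartzMap.smulLeftCLM ℂ (fun ξ => (A ξ ^ m) i j) ψ)‖ ≤ C := by
      intro j
      refine exists_uniform_bound (fun s : Set.Icc (0 : ℝ) t => Z s j) ?_ _ ?_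
      · intro φ
        obtain ⟨C, hC⟩ := isCompact_Icc.exists_bound_of_continuousOn (s := Set.Icc 0 t)
          (f := fun s => Z s j φ) (fun s hs =>
            ((hZ s hs.1 j φ).continuousWithinAt).mono Set.Icc_subset_Ici_self)
        exact ⟨C, fun s => hC s s.2⟩
      · intro k l
        obtain ⟨B, C, hB, hC, hBC⟩ := exists_seminorm_matrix_pow_le hA ψ hψ k l
        obtain ⟨D, hD⟩ := (FloorSemiring.tendsto_pow_div_factorial_atTop
          ((2 * t + 1) * B)).bddAbove_range
        refine ⟨C * D, fun m => ?_⟩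
        rw [map_smul_eq_mul, Complex.norm_real, Real.norm_of_nonneg (by positivity)]
        calc _ ≤ ((2 * t + 1) ^ m / m.factorial) * (C * B ^ m) := by
              gcongr
              exact hBC m i j
          _ = C * (((2 * t + 1) * B) ^ m / m.factorial) := by rw [mul_pow]; ring
          _ ≤ C * D := by
              gcongr
              exact hD ⟨m, rfl⟩
    choose C hC using h1
    refine ⟨∑ j, C j, fun m s hs => ?_⟩
    rw [Finset.sum_mul]
    refine norm_sum_le_of_le _ fun j _ => ?_
    have h2 := hC j ⟨s, hs⟩ m
    rw [map_smul, norm_smul, Complex.norm_real, Real.norm_of_nonneg (by positivity)] at h2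
    have h3 : (0 : ℝ) < (2 * t + 1) ^ m := by positivity
    have h4 : (0 : ℝ) < m.factorial := by exact_mod_cast m.factorial_pos
    rw [div_mul_eq_mul_div, div_le_iff₀ h4] at h2
    rw [← mul_div_assoc, le_div_iff₀ h3]
    linarith
  obtain ⟨C, hC⟩ := hbound
  have hC0 : 0 ≤ C := by simpa using (norm_nonneg _).trans (hC 0 0 ⟨le_rfl, ht⟩)
  have hsn : Summable fun m : ℕ => ‖((t : ℂ) ^ m / m.factorial) * f m 0‖ := by
    refine Summable.of_nonneg_of_le (fun _ => norm_nonneg _) (fun m => ?_)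
      ((summable_geometric_of_lt_one (by norm_num) (by norm_num : (1 / 2 : ℝ) < 1)).mul_left C)
    have h4 : (0 : ℝ) < m.factorial := by exact_mod_cast m.factorial_pos
    rw [norm_mul, norm_div, norm_pow, Complex.norm_real, Complex.norm_natCast,
      Real.norm_of_nonneg ht]
    calc _ ≤ (t ^ m / m.factorial) * (C * (m.factorial / (2 * t + 1) ^ m)) := by
          gcongr
          exact hC m 0 ⟨le_rfl, ht⟩
      _ = C * (t / (2 * t + 1)) ^ m := by
          rw [div_pow]
          field_simp
      _ ≤ C * (1 / 2) ^ m := by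
          have h5 : t / (2 * t + 1) ≤ 1 / 2 := by
            rw [div_le_div_iff₀ (by positivity) (by norm_num)]
            linarith
          gcongr
  refine (hsn.of_norm.hasSum_iff_tendsto_nat).2 ?_
  rw [tendsto_iff_norm_sub_tendsto_zero]
  have hlim : Tendsto (fun k : ℕ => C * (1 / 2 : ℝ) ^ k) atTop (𝓝 0) := by
    simpa using (tendsto_pow_atTop_nhds_zero_of_lt_one (by norm_num)
      (by norm_num : (1 / 2 : ℝ) < 1)).const_mul C
  refine squeeze_zero (fun _ => norm_nonneg _) (fun k => ?_) hlim
  have h5 := norm_sub_taylor_le t _ k f hf (hC k) t ⟨ht, le_rfl⟩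
  rw [← hf0, norm_sub_rev]
  refine h5.trans ?_
  have h4 : (0 : ℝ) < k.factorial := by exact_mod_cast k.factorial_pos
  calc _ = C * (t / (2 * t + 1)) ^ k := by
        rw [div_pow]
        field_simp
    _ ≤ _ := by
        have h6 : t / (2 * t + 1) ≤ 1 / 2 := by
          rw [div_le_div_iff₀ (by positivity) (by norm_num)]
          linarith
        gcongr

end Evolution

end MGT

namespace MGT

open scoped ContDiff Topology
open Filter

/-! ### A Lyapunov functional at fixed frequency. -/

section Lyapunov

/-- The matrix symbol of a dissipative first-order system which is satisfied by `V`. On gradient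
fields the block `η ηᵀ - |η|²` vanishes; it is there to make the system dissipative on all
vectors. -/
def symbol {n : ℕ} (τ κ : ℝ) (η : Fin n → ℝ) :
    Matrix (Unit ⊕ Fin n ⊕ Fin n) (Unit ⊕ Fin n ⊕ Fin n) ℂ
  | .inl _, .inl _ => 0
  | .inl _, .inr (.inl k) => Complex.I * η k
  | .inl _, .inr (.inr k) => κ * (Complex.I * η k)
  | .inr (.inl k), .inl _ => Complex.I * η k
  | .inr (.inl k), .inr (.inl l) => η k * η l - if k = l then ∑ m, (η m : ℂ) ^ 2 else 0
  | .inr (.inl _), .inr (.inr _) => 0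
  | .inr (.inr k), .inl _ => (τ : ℂ)⁻¹ * (Complex.I * η k)
  | .inr (.inr _), .inr (.inl _) => 0
  | .inr (.inr k), .inr (.inr l) => if k = l then -(τ : ℂ)⁻¹ else 0

/-- The left side is half the time derivative of the functional in `system_decay_aux`, with `P, B,
C` the squared norms of `a, b, c`, `g = |η·c|²`, `bb = |η·b|²`, `X = Im(ā η·c)` and `R =
Re(conj(η·b) η·c)`. With `δ = 1/(2τ)`, the gain `-r2 P/τ` from `X` pays twice for the loss `δ r2 P`
from the other cross term. -/
lemma dissipation_le {τ κ ε δ K w r2 P B C X R g bb : ℝ} (hτ : 0 < τ) (hκ : 0 < κ) (hε : 0 < ε)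
    (hδ : δ = 1 / (2 * τ)) (hK : K = (1 + κ * δ) ^ 2 / (2 * δ)) (hr : 0 ≤ r2)
    (hw : w * (1 + r2) = 1) (hP : 0 ≤ P) (hC : 0 ≤ C) (hg : 0 ≤ g) (hbb : 0 ≤ bb)
    (hX : X ^ 2 ≤ P * g) (hR : R ^ 2 ≤ bb * g) (hgC : g ≤ r2 * C)
    (hbB : bb ≤ r2 * B) (h1 : ε * (1 / τ + K + κ) ≤ κ / 2) (h2 : ε * δ ≤ 1 / 2) :
    -κ * C - (r2 * B - bb) + ε * w * (R + κ * g - r2 * P / τ + X / τ)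
        + ε * δ * w * (-bb - κ * R + r2 * P) ≤
      -(κ / 2 * C + ε * δ / 2 * (w * r2) * B + ε * δ / 2 * (w * r2) * P) := by
  have hδ0 : 0 < δ := by rw [hδ]; positivity
  have hK0 : 0 < K := by rw [hK]; positivity
  have hw0 : 0 < w := by
    by_contra h
    nlinarith
  have hw1 : w ≤ 1 := by nlinarith
  have hm1 : w * r2 ≤ 1 := by nlinarith
  have hm0 : 0 ≤ w * r2 := by positivity
  have eX : X ≤ r2 * P / 4 + C := by
    refine (le_abs_self X).trans (abs_le_of_sq_le_sq ?_ (by positivity))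
    nlinarith [mul_le_mul_of_nonneg_left hgC hP, sq_nonneg (r2 * P / 4 - C)]
  -- Young's inequality: `K` is chosen so that `2 δ K = (1 + κδ)²`.
  have eR : (1 - κ * δ) * R ≤ δ * bb / 2 + K * g := by
    have hKδ : 2 * δ * K = (1 + κ * δ) ^ 2 := by rw [hK]; field_simp
    have h3 : ((1 - κ * δ) * R) ^ 2 ≤ (δ * bb / 2 + K * g) ^ 2 := by
      have h4 : ((1 - κ * δ) * R) ^ 2 ≤ (1 + κ * δ) ^ 2 * (bb * g) := by
        rw [mul_pow]
        have h5 : (1 - κ * δ) ^ 2 ≤ (1 + κ * δ) ^ 2 := by nlinarith [mul_pos hκ hδ0]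
        exact mul_le_mul h5 hR (sq_nonneg _) (sq_nonneg _)
      rw [← hKδ] at h4
      nlinarith [sq_nonneg (δ * bb / 2 - K * g)]
    exact (le_abs_self _).trans (abs_le_of_sq_le_sq h3 (by positivity))
  have hδτ : 1 / τ = 2 * δ := by rw [hδ]; field_simp
  have e1 : ε * w * ((1 - κ * δ) * R) ≤ ε * w * (δ * bb / 2 + K * g) :=
    mul_le_mul_of_nonneg_left eR (by positivity)
  have e2 : ε * w * (2 * δ) * X ≤ ε * w * (2 * δ) * (r2 * P / 4 + C) :=
    mul_le_mul_of_nonneg_left eX (by positivity)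
  have e3 : ε * w * (K + κ) * g ≤ ε * (K + κ) * C := by
    have h8 : w * g ≤ C := calc
      w * g ≤ w * (r2 * C) := mul_le_mul_of_nonneg_left hgC hw0.le
      _ = w * r2 * C := by ring
      _ ≤ 1 * C := by gcongr
      _ = C := one_mul C
    calc ε * w * (K + κ) * g = ε * (K + κ) * (w * g) := by ring
      _ ≤ _ := by gcongr
  have e4 : ε * w * (2 * δ) * C ≤ ε * (2 * δ) * C := by
    have : ε * (2 * δ) * C * w ≤ ε * (2 * δ) * C * 1 :=
      mul_le_mul_of_nonneg_left hw1 (by positivity)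
    linarith
  have e5 : ε * (2 * δ + K + κ) * C ≤ κ / 2 * C := by
    rw [hδτ] at h1
    exact mul_le_mul_of_nonneg_right h1 hC
  -- What remains of the damping concerns only `bb`. A fraction of the orthogonal damping `r2 B -
  -- bb` completes it to damping of all of `b`.
  have e6 : ε * δ * w / 2 * (r2 * B - bb) ≤ r2 * B - bb := by
    have h6 : ε * δ * w ≤ 1 / 2 * 1 := mul_le_mul h2 hw1 hw0.le (by norm_num)
    have h7 : 0 ≤ r2 * B - bb := sub_nonneg.2 hbB
    exact mul_le_of_le_one_left h7 (by linarith)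
  have hsplit : -κ * C - (r2 * B - bb) + ε * w * (R + κ * g - r2 * P / τ + X / τ)
        + ε * δ * w * (-bb - κ * R + r2 * P) =
      -κ * C - (r2 * B - bb) + ε * w * ((1 - κ * δ) * R) + ε * w * κ * g
        + ε * w * (2 * δ) * X - ε * w * δ * r2 * P - ε * δ * w * bb := by
    rw [div_eq_mul_one_div _ τ, div_eq_mul_one_div X τ, hδτ]
    ring
  rw [hsplit]
  linarith

/-- The cross term carries one factor `|η|`, and `2|η| ≤ 1 + |η|²` is what the weight `w` absorbs.
-/
lemma cross_term_le {w r2 P Q X s : ℝ} (hr : 0 ≤ r2) (hw : w * (1 + r2) = 1) (hP : 0 ≤ P)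
    (hQ : 0 ≤ Q) (hX : X ^ 2 ≤ P * s) (hs : s ≤ r2 * Q) : |2 * w * X| ≤ P + Q := by
  have hw0 : 0 < w := by
    by_contra h
    nlinarith
  refine abs_le_of_sq_le_sq ?_ (by positivity)
  have h1 : X ^ 2 ≤ r2 * (P * Q) := by nlinarith [mul_le_mul_of_nonneg_left hs hP]
  have h2 : 4 * w ^ 2 * r2 ≤ 1 := by
    have : (w * (1 + r2)) ^ 2 = 1 := by rw [hw]; norm_num
    nlinarith [sq_nonneg (w * (1 - r2))]
  have h3 : 0 ≤ P * Q := mul_nonneg hP hQ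
  calc (2 * w * X) ^ 2 = 4 * w ^ 2 * X ^ 2 := by ring
    _ ≤ 4 * w ^ 2 * (r2 * (P * Q)) := by gcongr
    _ = 4 * w ^ 2 * r2 * (P * Q) := by ring
    _ ≤ 1 * (P * Q) := by gcongr
    _ ≤ (P + Q) ^ 2 := by nlinarith

/-- The first two smallness conditions absorb the errors in `dissipation_le`; the last two keep the
functional within half of the energy. -/
lemma exists_small_parameter (τ κ δ K : ℝ) (hτ : 0 < τ) (hκ : 0 < κ) (hδ : 0 < δ) (hK : 0 < K) :
    ∃ ε : ℝ, 0 < ε ∧ ε * (1 / τ + K + κ) ≤ κ / 2 ∧ ε * δ ≤ 1 / 2 ∧ ε * (1 + δ) ≤ 1 / 2 ∧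
      ε ≤ κ * τ / 2 := by
  have key : ∀ a : ℝ, 0 < a → ∀ b : ℝ, 0 < b → ∀ ε, ε ≤ b / a → ε * a ≤ b := by
    intro a ha b _ ε h
    rwa [le_div_iff₀ ha] at h
  refine ⟨min (κ / 2 / (1 / τ + K + κ)) (min ((1 / 2) / δ) (min ((1 / 2) / (1 + δ)) (κ * τ / 2))),
    by positivity, ?_, ?_, ?_, ?_⟩
  · exact key _ (by positivity) _ (by positivity) _ (min_le_left _ _)
  · exact key _ (by positivity) _ (by positivity) _ ((min_le_right _ _).trans (min_le_left _ _))
  · exact key _ (by positivity) _ (by positivity) _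
      ((min_le_right _ _).trans ((min_le_right _ _).trans (min_le_left _ _)))
  · exact (min_le_right _ _).trans ((min_le_right _ _).trans (min_le_right _ _))

lemma le_exp_mul_of_deriv_le {L L' : ℝ → ℝ} {μ : ℝ} (hL : ∀ t, HasDerivAt L (L' t) t)
    (h : ∀ t, L' t ≤ -μ * L t) (t : ℝ) (ht : 0 ≤ t) : L t ≤ Real.exp (-μ * t) * L 0 := by
  have hd : ∀ t, HasDerivAt (fun t => Real.exp (μ * t) * L t)
      (Real.exp (μ * t) * (μ * L t + L' t)) t := by
    intro t
    refine ((((hasDerivAt_id t).const_mul μ).exp).mul (hL t)).congr_deriv ?_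
    simp only [id]
    ring
  have hanti : Antitone fun t => Real.exp (μ * t) * L t := by
    refine antitone_of_deriv_nonpos (fun t => (hd t).differentiableAt) fun t => ?_
    rw [(hd t).deriv]
    exact mul_nonpos_of_nonneg_of_nonpos (Real.exp_pos _).le (by linarith [h t])
  have h1 := hanti ht
  simp only [mul_zero, Real.exp_zero, one_mul] at h1
  calc L t = Real.exp (-μ * t) * (Real.exp (μ * t) * L t) := by
        rw [← mul_assoc, ← Real.exp_add]
        simp
    _ ≤ _ := by gcongr

lemma hasDerivAt_conj_mul {u v : ℝ → ℂ} {u' v' : ℂ} {t : ℝ} (hu : HasDerivAt u u' t)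
    (hv : HasDerivAt v v' t) : HasDerivAt (fun t => (starRingEnd ℂ) (u t) * v t)
      ((starRingEnd ℂ) u' * v t + (starRingEnd ℂ) (u t) * v') t := by
  have h1 : HasDerivAt (fun t => (starRingEnd ℂ) (u t)) ((starRingEnd ℂ) u') t :=
    (Complex.conjCLE.toContinuousLinearMap.hasFDerivAt (x := u t)).comp_hasDerivAt t hu
  exact h1.mul hv

lemma hasDerivAt_re {u : ℝ → ℂ} {u' : ℂ} {t : ℝ} (hu : HasDerivAt u u' t) :
    HasDerivAt (fun t => (u t).re) u'.re t :=
  (Complex.reCLM.hasFDerivAt (x := u t)).comp_hasDerivAt t hu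

lemma hasDerivAt_im {u : ℝ → ℂ} {u' : ℂ} {t : ℝ} (hu : HasDerivAt u u' t) :
    HasDerivAt (fun t => (u t).im) u'.im t :=
  (Complex.imCLM.hasFDerivAt (x := u t)).comp_hasDerivAt t hu

lemma normSq_sum_mul_le {n : ℕ} (η : Fin n → ℝ) (b : Fin n → ℂ) :
    Complex.normSq (∑ k, (η k : ℂ) * b k) ≤ (∑ k, η k ^ 2) * ∑ k, Complex.normSq (b k) := by
  have h1 : ‖∑ k, (η k : ℂ) * b k‖ ≤ ∑ k, |η k| * ‖b k‖ :=
    norm_sum_le_of_le _ fun k _ => by simp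
  have h2 := Finset.sum_mul_sq_le_sq_mul_sq Finset.univ (fun k => |η k|) (fun k => ‖b k‖)
  simp only [sq_abs] at h2
  simp_rw [Complex.normSq_eq_norm_sq]
  exact (pow_le_pow_left₀ (norm_nonneg _) h1 2).trans h2

end Lyapunov

end MGT

namespace MGT

section Lyapunov

open Complex in
-- The functional is `L = P + B + κτC - 2εwX + 2εδwY` with `Y = Im(ā η·b)`. In the derivative of the
-- energy `P + B + κτC` the cross terms cancel, leaving `-2κC - 2(r2 B - bb)`. The term `-X`
-- contributes damping of `a`, and `Y` contributes damping of `η·b`.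
lemma system_decay_aux {n : ℕ} {τ κ ε δ K w : ℝ} (hτ : 0 < τ) (hκ : 0 < κ) (hε : 0 < ε)
    (hδ : δ = 1 / (2 * τ)) (hK : K = (1 + κ * δ) ^ 2 / (2 * δ)) (η : Fin n → ℝ)
    (hw : w * (1 + ∑ k, η k ^ 2) = 1)
    (h1 : ε * (1 / τ + K + κ) ≤ κ / 2) (h2 : ε * δ ≤ 1 / 2) (h3 : ε * (1 + δ) ≤ 1 / 2)
    (h4 : ε ≤ κ * τ / 2)
    (a : ℝ → ℂ) (b c : ℝ → Fin n → ℂ)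
    (ha : ∀ t, HasDerivAt a (I * (∑ k, (η k : ℂ) * b t k) + κ * (I * ∑ k, (η k : ℂ) * c t k)) t)
    (hb : ∀ t k, HasDerivAt (fun s => b s k)
      (I * η k * a t + (η k * (∑ l, (η l : ℂ) * b t l) - (∑ m, (η m : ℂ) ^ 2) * b t k)) t)
    (hc : ∀ t k, HasDerivAt (fun s => c s k) ((τ : ℂ)⁻¹ * (I * η k * a t - c t k)) t) :
    ∃ L L' : ℝ → ℝ, (∀ t, HasDerivAt L (L' t) t) ∧
      (∀ t, L' t ≤ -2 * (κ / 2 * (∑ k, normSq (c t k)) +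
        ε * δ / 2 * (w * ∑ k, η k ^ 2) * (∑ k, normSq (b t k)) +
        ε * δ / 2 * (w * ∑ k, η k ^ 2) * normSq (a t))) ∧
      (∀ t, |L t - (normSq (a t) + ∑ k, normSq (b t k) + κ * τ * ∑ k, normSq (c t k))| ≤
        (normSq (a t) + ∑ k, normSq (b t k) + κ * τ * ∑ k, normSq (c t k)) / 2) := by
  set r2 : ℝ := ∑ k, η k ^ 2 with hr2
  have hr : 0 ≤ r2 := Finset.sum_nonneg fun _ _ => sq_nonneg _
  have hr2c : (∑ m, (η m : ℂ) ^ 2) = (r2 : ℂ) := by simp [hr2]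
  simp only [hr2c] at hb
  have hδ0 : 0 < δ := by rw [hδ]; positivity
  let bt : ℝ → ℂ := fun t => ∑ k, (η k : ℂ) * b t k
  let ct : ℝ → ℂ := fun t => ∑ k, (η k : ℂ) * c t k
  have ha' : ∀ t, HasDerivAt a (I * bt t + κ * (I * ct t)) t := ha
  have hbt : ∀ t, HasDerivAt bt (I * r2 * a t) t := by
    intro t
    have := HasDerivAt.fun_sum (u := Finset.univ) fun k _ => (hb t k).const_mul (η k : ℂ)
    refine this.congr_deriv ?_
    have e : ∀ k, (η k : ℂ) * (I * η k * a t + (η k * bt t - r2 * b t k)) =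
        (I * a t + bt t) * (η k : ℂ) ^ 2 - r2 * ((η k : ℂ) * b t k) := fun k => by ring
    simp only [bt] at e
    simp_rw [e, Finset.sum_sub_distrib, ← Finset.mul_sum, hr2c]
    ring
  have hct : ∀ t, HasDerivAt ct ((τ : ℂ)⁻¹ * (I * r2 * a t - ct t)) t := by
    intro t
    have := HasDerivAt.fun_sum (u := Finset.univ) fun k _ => (hc t k).const_mul (η k : ℂ)
    refine this.congr_deriv ?_
    have e : ∀ k, (η k : ℂ) * ((τ : ℂ)⁻¹ * (I * η k * a t - c t k)) =
        (τ : ℂ)⁻¹ * (I * a t * (η k : ℂ) ^ 2 - (η k : ℂ) * c t k) := fun k => by ring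
    simp_rw [e, ← Finset.mul_sum, Finset.sum_sub_distrib, ← Finset.mul_sum, hr2c, ct]
    ring
  let P : ℝ → ℝ := fun t => normSq (a t)
  let B : ℝ → ℝ := fun t => ∑ k, normSq (b t k)
  let C : ℝ → ℝ := fun t => ∑ k, normSq (c t k)
  let X : ℝ → ℝ := fun t => ((starRingEnd ℂ) (a t) * ct t).im
  let Y : ℝ → ℝ := fun t => ((starRingEnd ℂ) (a t) * bt t).im
  let R : ℝ → ℝ := fun t => ((starRingEnd ℂ) (bt t) * ct t).re
  have hnS : ∀ z : ℂ, normSq z = ((starRingEnd ℂ) z * z).re := fun z => by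
    simp [normSq_apply]
  have hP : ∀ t, HasDerivAt P (-2 * Y t - 2 * κ * X t) t := by
    intro t
    have h := hasDerivAt_re (hasDerivAt_conj_mul (ha' t) (ha' t))
    simp only [← hnS] at h
    refine h.congr_deriv ?_
    simp [X, Y]
    ring
  have hB : ∀ t, HasDerivAt B (2 * Y t - 2 * r2 * B t + 2 * normSq (bt t)) t := by
    intro t
    have h := HasDerivAt.fun_sum (u := Finset.univ) fun k _ =>
      hasDerivAt_re (hasDerivAt_conj_mul (hb t k) (hb t k))
    simp only [← hnS] at h
    refine h.congr_deriv ?_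
    have hre : (bt t).re = ∑ k, η k * (b t k).re := by simp [bt]
    have him : (bt t).im = ∑ k, η k * (b t k).im := by simp [bt]
    have e : ∀ k, ((starRingEnd ℂ) (I * η k * a t + (η k * bt t - r2 * b t k)) * b t k +
        (starRingEnd ℂ) (b t k) * (I * η k * a t + (η k * bt t - r2 * b t k))).re =
        2 * ((a t).re + (bt t).im) * (η k * (b t k).im) +
        2 * ((bt t).re - (a t).im) * (η k * (b t k).re) - 2 * r2 * normSq (b t k) := by
      intro k
      simp [normSq_apply]
      ring
    simp only [bt] at e
    simp_rw [e, Finset.sum_sub_distrib, Finset.sum_add_distrib, ← Finset.mul_sum]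
    rw [← hre, ← him]
    simp [Y, B, normSq_apply, bt]
    ring
  have hC : ∀ t, HasDerivAt C (2 / τ * (X t - C t)) t := by
    intro t
    have h := HasDerivAt.fun_sum (u := Finset.univ) fun k _ =>
      hasDerivAt_re (hasDerivAt_conj_mul (hc t k) (hc t k))
    simp only [← hnS] at h
    refine h.congr_deriv ?_
    have hre : (ct t).re = ∑ k, η k * (c t k).re := by simp [ct]
    have him : (ct t).im = ∑ k, η k * (c t k).im := by simp [ct]
    have e : ∀ k, ((starRingEnd ℂ) ((τ : ℂ)⁻¹ * (I * η k * a t - c t k)) * c t k +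
        (starRingEnd ℂ) (c t k) * ((τ : ℂ)⁻¹ * (I * η k * a t - c t k))).re =
        2 / τ * ((a t).re * (η k * (c t k).im) - (a t).im * (η k * (c t k).re) -
          normSq (c t k)) := by
      intro k
      rw [← ofReal_inv]
      simp [normSq_apply]
      ring
    simp_rw [e, ← Finset.mul_sum, Finset.sum_sub_distrib, ← Finset.mul_sum]
    rw [← hre, ← him]
    have e2 : X t = (a t).re * (ct t).im - (a t).im * (ct t).re := by
      simp [X]
      ring
    rw [e2]
  have hX : ∀ t, HasDerivAt X (-R t - κ * normSq (ct t) + (r2 * P t - X t) / τ) t := by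
    intro t
    refine (hasDerivAt_im (hasDerivAt_conj_mul (ha' t) (hct t))).congr_deriv ?_
    rw [← ofReal_inv]
    simp [X, P, R, normSq_apply]
    ring
  have hY : ∀ t, HasDerivAt Y (-normSq (bt t) - κ * R t + r2 * P t) t := by
    intro t
    refine (hasDerivAt_im (hasDerivAt_conj_mul (ha' t) (hbt t))).congr_deriv ?_
    simp [P, R, normSq_apply]
    ring
  have hsq : ∀ z v : ℂ, ((starRingEnd ℂ) z * v).im ^ 2 ≤ normSq z * normSq v := by
    intro z v
    simp [normSq_apply]
    nlinarith [sq_nonneg (z.re * v.re + z.im * v.im)]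
  have hsqr : ∀ z v : ℂ, ((starRingEnd ℂ) z * v).re ^ 2 ≤ normSq z * normSq v := by
    intro z v
    simp [normSq_apply]
    nlinarith [sq_nonneg (z.re * v.im - z.im * v.re)]
  have hP0 : ∀ t, 0 ≤ P t := fun t => normSq_nonneg _
  have hB0 : ∀ t, 0 ≤ B t := fun t => Finset.sum_nonneg fun _ _ => normSq_nonneg _
  have hC0 : ∀ t, 0 ≤ C t := fun t => Finset.sum_nonneg fun _ _ => normSq_nonneg _
  refine ⟨fun t => P t + B t + κ * τ * C t - 2 * ε * w * X t + 2 * ε * δ * w * Y t, _,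
    fun t => ((((hP t).add (hB t)).add ((hC t).const_mul (κ * τ))).sub
      ((hX t).const_mul (2 * ε * w))).add ((hY t).const_mul (2 * ε * δ * w)), fun t => ?_,
      fun t => ?_⟩
  · have hd := dissipation_le (τ := τ) (κ := κ) (ε := ε) (δ := δ) (K := K) (w := w) (r2 := r2)
      (P := P t) (B := B t) (C := C t) (X := X t) (R := R t) (g := normSq (ct t))
      (bb := normSq (bt t)) hτ hκ hε hδ hK hr hw (hP0 t) (hC0 t)
      (normSq_nonneg _) (normSq_nonneg _) (hsq _ _) (hsqr _ _) (normSq_sum_mul_le _ _)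
      (normSq_sum_mul_le _ _) h1 h2
    have e : κ * τ * (2 / τ * (X t - C t)) = 2 * κ * (X t - C t) := by field_simp
    rw [e]
    change _ ≤ -2 * (κ / 2 * C t + ε * δ / 2 * (w * r2) * B t + ε * δ / 2 * (w * r2) * P t)
    have e2 : (r2 * P t - X t) / τ = r2 * P t / τ - X t / τ := sub_div _ _ _
    rw [e2]
    linarith
  · have hx := cross_term_le hr hw (hP0 t) (hC0 t) (hsq (a t) (ct t)) (normSq_sum_mul_le _ _)
    have hy := cross_term_le hr hw (hP0 t) (hB0 t) (hsq (a t) (bt t)) (normSq_sum_mul_le _ _)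
    change |P t + B t + κ * τ * C t - 2 * ε * w * X t + 2 * ε * δ * w * Y t -
      (P t + B t + κ * τ * C t)| ≤ (P t + B t + κ * τ * C t) / 2
    have e : P t + B t + κ * τ * C t - 2 * ε * w * X t + 2 * ε * δ * w * Y t -
      (P t + B t + κ * τ * C t) = ε * δ * (2 * w * Y t) - ε * (2 * w * X t) := by ring
    rw [e]
    calc _ ≤ |ε * δ * (2 * w * Y t)| + |ε * (2 * w * X t)| := abs_sub _ _
      _ = ε * δ * |2 * w * Y t| + ε * |2 * w * X t| := by
          rw [abs_mul (ε * δ), abs_mul ε (2 * w * X t), abs_of_pos (mul_pos hε hδ0),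
            abs_of_pos hε]
      _ ≤ ε * δ * (P t + B t) + ε * (P t + C t) := by gcongr
      _ = ε * (1 + δ) * P t + ε * δ * B t + ε * C t := by ring
      _ ≤ 1 / 2 * P t + 1 / 2 * B t + κ * τ / 2 * C t := by
          have := hP0 t
          have := hB0 t
          have := hC0 t
          gcongr
      _ = _ := by ring

/-- Exponential decay of the solutions of the system with symbol `symbol τ κ η`. -/
lemma system_decay {τ κ : ℝ} (hτ : 0 < τ) (hκ : 0 < κ) : ∃ C c : ℝ, 0 < C ∧ 0 < c ∧
    ∀ (n : ℕ) (η : Fin n → ℝ) (y : ℝ → Unit ⊕ Fin n ⊕ Fin n → ℂ),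
      (∀ t i, HasDerivAt (fun s => y s i) ((symbol τ κ η).mulVec (y t) i) t) →
      ∀ t, 0 ≤ t → ∑ i, ‖y t i‖ ^ 2 ≤
        C * Real.exp (-(c * ((∑ k, η k ^ 2) / (1 + ∑ k, η k ^ 2))) * t) * ∑ i, ‖y 0 i‖ ^ 2 := by
  obtain ⟨δ, hδ⟩ : ∃ δ, δ = 1 / (2 * τ) := ⟨_, rfl⟩
  have hδ0 : 0 < δ := by rw [hδ]; positivity
  obtain ⟨K, hK⟩ : ∃ K, K = (1 + κ * δ) ^ 2 / (2 * δ) := ⟨_, rfl⟩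
  have hK0 : 0 < K := by rw [hK]; positivity
  obtain ⟨ε, hε, h1, h2, h3, h4⟩ := exists_small_parameter τ κ δ K hτ hκ hδ0 hK0
  let Λ : ℝ := max 1 (κ * τ)
  let lam : ℝ := min 1 (κ * τ)
  let c₀ : ℝ := min (κ / 2) (ε * δ / 2)
  have hΛ : 0 < Λ := lt_max_of_lt_left one_pos
  have hlam : 0 < lam := lt_min one_pos (by positivity)
  have hc₀ : 0 < c₀ := lt_min (by positivity) (by positivity)
  -- The functional lies between `lam/2` and `3Λ/2` times `∑ ‖y i‖²`. The prefactor is the quotient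
  -- of these bounds, and the rate is `2c₀` divided by the upper one.
  refine ⟨3 * Λ / lam, 4 * c₀ / (3 * Λ), by positivity, by positivity, ?_⟩
  intro n η y hy t ht
  set r2 : ℝ := ∑ k, η k ^ 2 with hr2
  have hr : 0 ≤ r2 := Finset.sum_nonneg fun _ _ => sq_nonneg _
  have hw : 1 / (1 + r2) * (1 + r2) = 1 := by field_simp
  obtain ⟨L, L', hL, hL', hLE⟩ := system_decay_aux hτ hκ hε hδ hK η hw h1 h2 h3 h4
    (fun t => y t (.inl ())) (fun t k => y t (.inr (.inl k))) (fun t k => y t (.inr (.inr k)))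
    (fun t => (hy t (.inl ())).congr_deriv (by
      simp [Matrix.mulVec, dotProduct, symbol, Finset.mul_sum, mul_assoc]))
    (fun t k => (hy t (.inr (.inl k))).congr_deriv (by
      simp [Matrix.mulVec, dotProduct, symbol, Finset.mul_sum, sub_mul, mul_assoc,
        Finset.sum_sub_distrib]))
    (fun t k => (hy t (.inr (.inr k))).congr_deriv (by
      simp [Matrix.mulVec, dotProduct, symbol, mul_assoc, sub_eq_add_neg]
      ring))
  let m : ℝ := r2 / (1 + r2)
  have hm : 1 / (1 + r2) * r2 = m := by simp only [m]; ring
  have hm0 : 0 ≤ m := by positivity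
  have hm1 : m ≤ 1 := by
    rw [div_le_one (by positivity)]
    linarith
  have hE : ∀ t, ∑ i, ‖y t i‖ ^ 2 = Complex.normSq (y t (.inl ())) +
      ∑ k, Complex.normSq (y t (.inr (.inl k))) + ∑ k, Complex.normSq (y t (.inr (.inr k))) := by
    intro t
    simp [Complex.normSq_eq_norm_sq, add_assoc]
  have hP0 : ∀ t, 0 ≤ Complex.normSq (y t (.inl ())) := fun t => Complex.normSq_nonneg _
  have hB0 : ∀ t, 0 ≤ ∑ k, Complex.normSq (y t (.inr (.inl k))) :=
    fun t => Finset.sum_nonneg fun _ _ => Complex.normSq_nonneg _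
  have hC0 : ∀ t, 0 ≤ ∑ k, Complex.normSq (y t (.inr (.inr k))) :=
    fun t => Finset.sum_nonneg fun _ _ => Complex.normSq_nonneg _
  have hup : ∀ t, L t ≤ 3 / 2 * Λ * ∑ i, ‖y t i‖ ^ 2 := by
    intro t
    have h5 := (abs_le.1 (hLE t)).2
    have h6 : (1 : ℝ) ≤ Λ := le_max_left _ _
    have h7 : κ * τ ≤ Λ := le_max_right _ _
    rw [hE]
    nlinarith [mul_le_mul_of_nonneg_right h6 (hP0 t), mul_le_mul_of_nonneg_right h6 (hB0 t),
      mul_le_mul_of_nonneg_right h7 (hC0 t)]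
  have hlow : ∀ t, lam / 2 * ∑ i, ‖y t i‖ ^ 2 ≤ L t := by
    intro t
    have h5 := (abs_le.1 (hLE t)).1
    have h6 : lam ≤ 1 := min_le_left _ _
    have h7 : lam ≤ κ * τ := min_le_right _ _
    rw [hE]
    nlinarith [mul_le_mul_of_nonneg_right h6 (hP0 t), mul_le_mul_of_nonneg_right h6 (hB0 t),
      mul_le_mul_of_nonneg_right h7 (hC0 t)]
  have hdec : ∀ t, L' t ≤ -(4 * c₀ / (3 * Λ) * m) * L t := by
    intro t
    refine (hL' t).trans ?_
    rw [hm]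
    have h6 : c₀ ≤ κ / 2 := min_le_left _ _
    have h7 : c₀ ≤ ε * δ / 2 := min_le_right _ _
    have h8 : c₀ * m ≤ κ / 2 := by nlinarith
    have h9 : c₀ * m ≤ ε * δ / 2 * m := mul_le_mul_of_nonneg_right h7 hm0
    have h10 : 4 * c₀ / (3 * Λ) * m * L t ≤ 2 * (c₀ * m) * ∑ i, ‖y t i‖ ^ 2 := calc
      _ ≤ 4 * c₀ / (3 * Λ) * m * (3 / 2 * Λ * ∑ i, ‖y t i‖ ^ 2) := by
        gcongr
        exact hup t
      _ = _ := by field_simp; ring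
    rw [hE] at h10
    have h11 := mul_le_mul_of_nonneg_right h9 (hP0 t)
    have h12 := mul_le_mul_of_nonneg_right h9 (hB0 t)
    have h13 := mul_le_mul_of_nonneg_right h8 (hC0 t)
    linarith
  have hfin := le_exp_mul_of_deriv_le hL hdec t ht
  have h14 : lam / 2 * ∑ i, ‖y t i‖ ^ 2 ≤
      Real.exp (-(4 * c₀ / (3 * Λ) * m) * t) * (3 / 2 * Λ * ∑ i, ‖y 0 i‖ ^ 2) :=
    (hlow t).trans (hfin.trans (by gcongr; exact hup 0))
  calc _ = 2 / lam * (lam / 2 * ∑ i, ‖y t i‖ ^ 2) := by field_simp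
    _ ≤ 2 / lam * (Real.exp (-(4 * c₀ / (3 * Λ) * m) * t) * (3 / 2 * Λ * ∑ i, ‖y 0 i‖ ^ 2)) := by
        gcongr
    _ = 3 * Λ / lam * Real.exp (-(4 * c₀ / (3 * Λ) * m) * t) * ∑ i, ‖y 0 i‖ ^ 2 := by
        generalize Real.exp (-(4 * c₀ / (3 * Λ) * m) * t) = e
        field_simp

end Lyapunov

end MGT

namespace MGT

/-! ### The matrix exponential of the symbol. -/

section Propagator

open scoped Matrix.Norms.Operator

variable {ι : Type*} [Fintype ι] [DecidableEq ι]

lemma hasSum_exp_smul_apply (A : Matrix ι ι ℂ) (t : ℝ) (i j : ι) :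
    HasSum (fun m : ℕ => ((t : ℂ) ^ m / m.factorial) * (A ^ m) i j)
      (NormedSpace.exp ((t : ℂ) • A) i j) := by
  have h := NormedSpace.exp_series_hasSum_exp' (𝕂 := ℂ) ((t : ℂ) • A)
  have h1 := (Pi.hasSum.1 (Pi.hasSum.1 h i)) j
  have e : (fun m : ℕ => ((t : ℂ) ^ m / m.factorial) * (A ^ m) i j) =
      fun m : ℕ => ((m.factorial : ℂ)⁻¹ • ((t : ℂ) • A) ^ m) i j := by
    ext m
    simp [smul_pow, div_eq_inv_mul, mul_assoc]
  rw [e]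
  exact h1

lemma hasDerivAt_exp_smul_mulVec (A : Matrix ι ι ℂ) (v : ι → ℂ) (t : ℝ) (i : ι) :
    HasDerivAt (fun s : ℝ => (NormedSpace.exp ((s : ℂ) • A)).mulVec v i)
      (A.mulVec ((NormedSpace.exp ((t : ℂ) • A)).mulVec v) i) t := by
  have h : HasDerivAt (fun s : ℝ => NormedSpace.exp ((s : ℂ) • A))
      (A * NormedSpace.exp ((t : ℂ) • A)) t := by
    have h1 := (hasDerivAt_exp_smul_const' (𝕂 := ℂ) A (t : ℂ)).scomp t
      (Complex.ofRealCLM.hasDerivAt (x := t))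
    rw [Complex.ofRealCLM_apply, Complex.ofReal_one, one_smul] at h1
    exact h1
  let Φ : Matrix ι ι ℂ →L[ℝ] ℂ := LinearMap.toContinuousLinearMap
    { toFun := fun M => M.mulVec v i
      map_add' := fun M N => by rw [Matrix.add_mulVec]; rfl
      map_smul' := fun r M => by rw [Matrix.smul_mulVec]; rfl }
  have h2 := (Φ.hasFDerivAt (x := NormedSpace.exp ((t : ℂ) • A))).comp_hasDerivAt t h
  refine h2.congr_deriv ?_
  change (A * NormedSpace.exp ((t : ℂ) • A)).mulVec v i = _
  rw [Matrix.mulVec_mulVec]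

lemma continuous_exp_smul {X : Type*} [TopologicalSpace X] {A : X → Matrix ι ι ℂ}
    (hA : Continuous A) (t : ℝ) (i j : ι) :
    Continuous fun x => NormedSpace.exp ((t : ℂ) • A x) i j := by
  have h : Continuous fun x => NormedSpace.exp ((t : ℂ) • A x) :=
    (NormedSpace.exp_continuous (𝔸 := Matrix ι ι ℂ)).comp (hA.const_smul (t : ℂ))
  exact h.matrix_elem i j

/-- `system_decay` applied to `exp(tA)v`; taking square roots halves the rate. -/
lemma propagator_decay {τ κ : ℝ} (hτ : 0 < τ) (hκ : 0 < κ) : ∃ C c : ℝ, 0 < C ∧ 0 < c ∧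
    ∀ (n : ℕ) (η : Fin n → ℝ) (v : Unit ⊕ Fin n ⊕ Fin n → ℂ) (t : ℝ), 0 ≤ t → ∀ i,
      ‖(NormedSpace.exp ((t : ℂ) • symbol τ κ η)).mulVec v i‖ ≤
        C * Real.exp (-(c * ((∑ k, η k ^ 2) / (1 + ∑ k, η k ^ 2))) * t) * ∑ i, ‖v i‖ := by
  obtain ⟨C, c, hC, hc, h⟩ := system_decay hτ hκ
  refine ⟨√C, c / 2, by positivity, by positivity, fun n η v t ht i => ?_⟩
  have h1 := h n η (fun s => (NormedSpace.exp ((s : ℂ) • symbol τ κ η)).mulVec v)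
    (fun t i => hasDerivAt_exp_smul_mulVec _ v t i) t ht
  simp only [Complex.ofReal_zero, zero_smul, NormedSpace.exp_zero, Matrix.one_mulVec] at h1
  set r : ℝ := (∑ k, η k ^ 2) / (1 + ∑ k, η k ^ 2)
  refine (abs_le_of_sq_le_sq' ?_ (by positivity)).2
  have h2 := (Finset.single_le_sum (f := fun i =>
    ‖(NormedSpace.exp ((t : ℂ) • symbol τ κ η)).mulVec v i‖ ^ 2)
    (fun _ _ => sq_nonneg _) (Finset.mem_univ i)).trans h1
  have h3 : ∑ i, ‖v i‖ ^ 2 ≤ (∑ i, ‖v i‖) ^ 2 :=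
    Finset.sum_sq_le_sq_sum_of_nonneg fun _ _ => norm_nonneg _
  have h4 : Real.exp (-(c / 2 * r) * t) ^ 2 = Real.exp (-(c * r) * t) := by
    rw [sq, ← Real.exp_add]
    congr 1
    ring
  refine h2.trans ?_
  rw [mul_pow, mul_pow, Real.sq_sqrt hC.le, h4]
  gcongr

end Propagator

end MGT

namespace MGT

/-! ### The first-order system satisfied by the Fourier transform of `V`. -/

section Equation

open scoped Topology FourierTransform
open Filter

/-- The symbol of the system for `V`, as a function of the frequency variable of Mathlib's Fourier
transform. -/
def freqSymbol {n : ℕ} (τ κ : ℝ) (ξ : Rn n) :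
    Matrix (Unit ⊕ Fin n ⊕ Fin n) (Unit ⊕ Fin n ⊕ Fin n) ℂ :=
  symbol τ κ fun k => 2 * Real.pi * ξ k

lemma hasTemperateGrowth_coord {n : ℕ} (k : Fin n) :
    (fun ξ : Rn n => ((2 * Real.pi * ξ k : ℝ) : ℂ)).HasTemperateGrowth := by
  have h1 : (fun ξ : Rn n => ξ k).HasTemperateGrowth :=
    (EuclideanSpace.proj (𝕜 := ℝ) k).hasTemperateGrowth
  have h2 : (fun ξ : Rn n => 2 * Real.pi * ξ k).HasTemperateGrowth :=
    (Function.HasTemperateGrowth.const _).mul h1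
  fun_prop

lemma hasTemperateGrowth_freqSymbol {n : ℕ} (τ κ : ℝ) (i j : Unit ⊕ Fin n ⊕ Fin n) :
    (fun ξ : Rn n => freqSymbol τ κ ξ i j).HasTemperateGrowth := by
  have hc := hasTemperateGrowth_coord (n := n)
  have h0 : ∀ c : ℂ, (fun _ : Rn n => c).HasTemperateGrowth := Function.HasTemperateGrowth.const
  have hsum : (fun ξ : Rn n => ∑ m, ((2 * Real.pi * ξ m : ℝ) : ℂ) ^ 2).HasTemperateGrowth :=
    Function.HasTemperateGrowth.sum fun m _ => (hc m).pow 2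
  rcases i with _ | k | k <;> rcases j with _ | l | l <;> simp only [freqSymbol, symbol]
  · exact h0 0
  · exact (h0 _).mul (hc _)
  · exact (h0 _).mul ((h0 _).mul (hc _))
  · exact (h0 _).mul (hc _)
  · split_ifs
    · exact ((hc k).mul (hc l)).sub hsum
    · exact ((hc k).mul (hc l)).sub (h0 0)
  · exact h0 0
  · exact (h0 _).mul ((h0 _).mul (hc _))
  · exact h0 0
  · split_ifs <;> exact h0 _

/-- Multiplication of a Schwartz function by the symbol of the `k`-th partial derivative. -/
def mulCoord {n : ℕ} (k : Fin n) : 𝓢(Rn n, ℂ) →L[ℂ] 𝓢(Rn n, ℂ) :=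
  SchwartzMap.smulLeftCLM ℂ fun ξ : Rn n => Complex.I * ((2 * Real.pi * ξ k : ℝ) : ℂ)

lemma mulCoord_apply {n : ℕ} (k : Fin n) (ψ : 𝓢(Rn n, ℂ)) (ξ : Rn n) :
    mulCoord k ψ ξ = Complex.I * ((2 * Real.pi * ξ k : ℝ) : ℂ) * ψ ξ := by
  have h : (fun ξ : Rn n => Complex.I * ((2 * Real.pi * ξ k : ℝ) : ℂ)).HasTemperateGrowth :=
    (Function.HasTemperateGrowth.const _).mul (hasTemperateGrowth_coord k)
  rw [mulCoord, SchwartzMap.smulLeftCLM_apply_apply h, smul_eq_mul]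

lemma fourier_pderiv_apply {n : ℕ} (k : Fin n) (f : 𝓢'(Rn n, ℂ)) (ψ : 𝓢(Rn n, ℂ)) :
    𝓕 (pderiv k f) ψ = 𝓕 f (mulCoord k ψ) := by
  rw [pderiv, TemperedDistribution.fourier_lineDerivOp_eq]
  simp only [smul_apply, TemperedDistribution.smulLeftCLM_apply_apply]
  rw [← map_smul]
  congr 1
  ext ξ
  rw [mulCoord_apply, smul_apply,
    SchwartzMap.smulLeftCLM_apply_apply (by fun_prop)]
  simp [EuclideanSpace.inner_single_right]
  ring

lemma fourier_laplacian_apply {n : ℕ} (f : 𝓢'(Rn n, ℂ)) (ψ : 𝓢(Rn n, ℂ)) :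
    𝓕 (Δ f) ψ = ∑ k, 𝓕 f (mulCoord k (mulCoord k ψ)) := by
  rw [TemperedDistribution.laplacian_eq_sum (EuclideanSpace.basisFun (Fin n) ℝ) f]
  simp only [EuclideanSpace.basisFun_apply]
  change 𝓕 (∑ k, pderiv k (pderiv k f)) ψ = _
  rw [TemperedDistribution.fourier_apply, sum_apply]
  refine Finset.sum_congr rfl fun k _ => ?_
  rw [← TemperedDistribution.fourier_apply, fourier_pderiv_apply, fourier_pderiv_apply]

/-- The time derivative of `V`, expressed through the equation. -/
def vecDeriv {n : ℕ} (τ β : ℝ) (u ut utt : 𝓢'(Rn n, ℂ)) : Unit ⊕ Fin n ⊕ Fin n → 𝓢'(Rn n, ℂ)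
  | .inl _ => Δ u + (β : ℂ) • Δ ut
  | .inr (.inl j) => pderiv j (ut + (τ : ℂ) • utt)
  | .inr (.inr j) => pderiv j utt

lemma hasDerivWithinAt_vec {n : ℕ} {τ β : ℝ} {u₀ u₁ u₂ : 𝓢'(Rn n, ℂ)}
    {u ut utt : ℝ → 𝓢'(Rn n, ℂ)} (h : IsSolution τ β u₀ u₁ u₂ u ut utt) (t : ℝ) (ht : 0 ≤ t)
    (i : Unit ⊕ Fin n ⊕ Fin n) (ψ : 𝓢(Rn n, ℂ)) :
    HasDerivWithinAt (fun s => vec τ (u s) (ut s) (utt s) i ψ)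
      (vecDeriv τ β (u t) (ut t) (utt t) i ψ) (Set.Ici 0) t := by
  rcases i with _ | k | k
  · change HasDerivWithinAt (fun s => ut s ψ + (τ : ℂ) * utt s ψ)
      ((Δ (u t)) ψ + (β : ℂ) * (Δ (ut t)) ψ) (Set.Ici 0) t
    have hpos : ∀ t, 0 < t → HasDerivAt (fun s => ut s ψ + (τ : ℂ) * utt s ψ)
        ((Δ (u t)) ψ + (β : ℂ) * (Δ (ut t)) ψ) t := by
      intro t ht
      obtain ⟨uttt, h1, h2⟩ := h.equation t ht
      have h3 := ((h.deriv_ut t ht.le ψ).hasDerivAt (Ici_mem_nhds ht)).add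
        ((h1 ψ).const_mul (τ : ℂ))
      refine h3.congr_deriv ?_
      have h4 : ((τ : ℂ) • uttt + utt t - Δ (u t) - (β : ℂ) • Δ (ut t)) ψ = 0 := by
        rw [h2]
        rfl
      have h5 : (τ : ℂ) * uttt ψ + utt t ψ - (Δ (u t)) ψ - (β : ℂ) * (Δ (ut t)) ψ = 0 := h4
      linear_combination h5
    rcases ht.eq_or_lt with rfl | ht
    -- The equation holds only for `t > 0`. At `t = 0` the one-sided derivative exists because the
    -- derivative for `t > 0` equals `Δu + βΔu_t`, which is continuous up to `0`.
    · have hcont : ∀ φ : 𝓢(Rn n, ℂ), ContinuousWithinAt (fun s => ut s φ) (Set.Ioi 0) 0 :=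
        fun φ => (h.deriv_ut 0 le_rfl φ).continuousWithinAt.mono Set.Ioi_subset_Ici_self
      have hcontu : ∀ φ : 𝓢(Rn n, ℂ), ContinuousWithinAt (fun s => u s φ) (Set.Ioi 0) 0 :=
        fun φ => (h.deriv_u 0 le_rfl φ).continuousWithinAt.mono Set.Ioi_subset_Ici_self
      refine hasDerivWithinAt_Ici_of_tendsto_deriv (s := Set.Ioi 0) ?_ ?_ self_mem_nhdsWithin ?_
      · exact fun s hs => (hpos s hs).differentiableAt.differentiableWithinAt
      · exact (hcont ψ).add (((h.continuousOn_utt ψ) 0 Set.self_mem_Ici |>.mono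
          Set.Ioi_subset_Ici_self).const_mul _)
      · have h6 : Tendsto (fun s => (Δ (u s)) ψ + (β : ℂ) * (Δ (ut s)) ψ) (𝓝[>] 0)
            (𝓝 ((Δ (u 0)) ψ + (β : ℂ) * (Δ (ut 0)) ψ)) := by
          simp only [TemperedDistribution.laplacian_apply_apply]
          exact (hcontu _).add ((hcont _).const_mul _)
        refine h6.congr' ?_
        filter_upwards [self_mem_nhdsWithin] with s hs
        exact (hpos s hs).deriv.symm
    · exact (hpos t ht).hasDerivWithinAt
  · exact (h.deriv_u t ht _).add ((h.deriv_ut t ht _).const_mul (τ : ℂ)) |>.congr_deriv rfl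
  · exact h.deriv_ut t ht _

/-- The three rows encode `Δu + βΔu_t = div ∇(u + τu_t) + (β - τ) div ∇u_t`, the trivial `∇(u +
τu_t)_t = ∇(u_t + τu_tt)`, and `τ∇u_tt = ∇(u_t + τu_tt) - ∇u_t`. -/
lemma fourier_vecDeriv_apply {n : ℕ} {τ β : ℝ} (hτ : τ ≠ 0) (u ut utt : 𝓢'(Rn n, ℂ))
    (i : Unit ⊕ Fin n ⊕ Fin n) (ψ : 𝓢(Rn n, ℂ)) :
    𝓕 (vecDeriv τ β u ut utt i) ψ = ∑ j, 𝓕 (vec τ u ut utt j)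
      (SchwartzMap.smulLeftCLM ℂ (fun ξ => freqSymbol τ (β - τ) ξ i j) ψ) := by
  have hadd : ∀ f g : 𝓢'(Rn n, ℂ), ∀ (c : ℂ) (χ : 𝓢(Rn n, ℂ)),
      𝓕 (f + c • g) χ = 𝓕 f χ + c * 𝓕 g χ := fun f g c χ => rfl
  have hS : ∀ (j : Unit ⊕ Fin n ⊕ Fin n) (ξ : Rn n),
      SchwartzMap.smulLeftCLM ℂ (fun ξ => freqSymbol τ (β - τ) ξ i j) ψ ξ =
        freqSymbol τ (β - τ) ξ i j * ψ ξ := fun j ξ => by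
    rw [SchwartzMap.smulLeftCLM_apply_apply (hasTemperateGrowth_freqSymbol _ _ _ _), smul_eq_mul]
  have hτ' : (τ : ℂ) ≠ 0 := by exact_mod_cast hτ
  rw [Fintype.sum_sum_type, Fintype.sum_sum_type, Fintype.sum_unique]
  rcases i with _ | k | k
  · have e0 : SchwartzMap.smulLeftCLM ℂ (fun ξ : Rn n => freqSymbol τ (β - τ) ξ (.inl ())
        (.inl default)) ψ = 0 := by
      ext ξ; rw [hS]; simp [freqSymbol, symbol]
    have e1 : ∀ l, SchwartzMap.smulLeftCLM ℂ (fun ξ : Rn n => freqSymbol τ (β - τ) ξ (.inl ())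
        (.inr (.inl l))) ψ = mulCoord l ψ := by
      intro l; ext ξ; rw [hS, mulCoord_apply]; simp [freqSymbol, symbol]
    have e2 : ∀ l, SchwartzMap.smulLeftCLM ℂ (fun ξ : Rn n => freqSymbol τ (β - τ) ξ (.inl ())
        (.inr (.inr l))) ψ = ((β - τ : ℝ) : ℂ) • mulCoord l ψ := by
      intro l; ext ξ; rw [hS, smul_apply, mulCoord_apply]
      simp [freqSymbol, symbol]; ring
    simp only [e0, e1, e2, vec, vecDeriv, hadd, fourier_pderiv_apply, fourier_laplacian_apply,
      map_zero, map_smul, zero_add, smul_eq_mul, Finset.sum_add_distrib, ← Finset.mul_sum]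
    push_cast
    ring
  · have e0 : SchwartzMap.smulLeftCLM ℂ (fun ξ : Rn n => freqSymbol τ (β - τ) ξ (.inr (.inl k))
        (.inl default)) ψ = mulCoord k ψ := by
      ext ξ; rw [hS, mulCoord_apply]; simp [freqSymbol, symbol]
    have e2 : ∀ l, SchwartzMap.smulLeftCLM ℂ (fun ξ : Rn n => freqSymbol τ (β - τ) ξ
        (.inr (.inl k)) (.inr (.inr l))) ψ = 0 := by
      intro l; ext ξ; rw [hS]; simp [freqSymbol, symbol]
    -- The artificial block `η ηᵀ - |η|²` annihilates multiples of `η`, hence gradients.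
    have e1 : ∑ l, mulCoord l (SchwartzMap.smulLeftCLM ℂ (fun ξ : Rn n =>
        freqSymbol τ (β - τ) ξ (.inr (.inl k)) (.inr (.inl l))) ψ) = 0 := by
      ext ξ
      rw [sum_apply]
      simp only [mulCoord_apply, hS]
      simp only [freqSymbol, symbol]
      have e : ∀ l, Complex.I * ((2 * Real.pi * ξ l : ℝ) : ℂ) *
          ((((2 * Real.pi * ξ k : ℝ) : ℂ) * ((2 * Real.pi * ξ l : ℝ) : ℂ) -
            if k = l then ∑ m, ((2 * Real.pi * ξ m : ℝ) : ℂ) ^ 2 else 0) * ψ ξ) =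
          Complex.I * ψ ξ * ((2 * Real.pi * ξ k : ℝ) : ℂ) * ((2 * Real.pi * ξ l : ℝ) : ℂ) ^ 2 -
          if k = l then Complex.I * ((2 * Real.pi * ξ l : ℝ) : ℂ) * ψ ξ *
            ∑ m, ((2 * Real.pi * ξ m : ℝ) : ℂ) ^ 2 else 0 := by
        intro l
        split_ifs <;> ring
      simp_rw [e, Finset.sum_sub_distrib, ← Finset.mul_sum]
      simp
      ring
    have e3 : ∀ f : 𝓢'(Rn n, ℂ), ∑ l, 𝓕 f (mulCoord l (SchwartzMap.smulLeftCLM ℂ (fun ξ : Rn n =>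
        freqSymbol τ (β - τ) ξ (.inr (.inl k)) (.inr (.inl l))) ψ)) = 0 := by
      intro f
      rw [← map_sum, e1, map_zero]
    simp only [e0, e2, vec, vecDeriv, fourier_pderiv_apply, e3, map_zero, Finset.sum_const_zero,
      add_zero]
  · have e0 : SchwartzMap.smulLeftCLM ℂ (fun ξ : Rn n => freqSymbol τ (β - τ) ξ (.inr (.inr k))
        (.inl default)) ψ = (τ : ℂ)⁻¹ • mulCoord k ψ := by
      ext ξ; rw [hS, smul_apply, mulCoord_apply]; simp [freqSymbol, symbol]; ring
    have e1 : ∀ l, SchwartzMap.smulLeftCLM ℂ (fun ξ : Rn n => freqSymbol τ (β - τ) ξ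
        (.inr (.inr k)) (.inr (.inl l))) ψ = 0 := by
      intro l; ext ξ; rw [hS]; simp [freqSymbol, symbol]
    have e2 : ∀ l, SchwartzMap.smulLeftCLM ℂ (fun ξ : Rn n => freqSymbol τ (β - τ) ξ
        (.inr (.inr k)) (.inr (.inr l))) ψ = (if k = l then -(τ : ℂ)⁻¹ else 0) • ψ := by
      intro l; ext ξ; rw [hS, smul_apply]; simp [freqSymbol, symbol]
    simp only [e0, e1, e2, vec, vecDeriv, hadd, fourier_pderiv_apply, map_zero, map_smul,
      Finset.sum_const_zero, zero_add, smul_eq_mul, ite_mul, zero_mul, Finset.sum_ite_eq,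
      Finset.mem_univ, if_true]
    field_simp
    ring

/-- In Fourier variables, `V` solves a linear system of ordinary differential equations. -/
lemma hasDerivWithinAt_fourier_vec {n : ℕ} {τ β : ℝ} (hτ : τ ≠ 0) {u₀ u₁ u₂ : 𝓢'(Rn n, ℂ)}
    {u ut utt : ℝ → 𝓢'(Rn n, ℂ)} (h : IsSolution τ β u₀ u₁ u₂ u ut utt) (t : ℝ) (ht : 0 ≤ t)
    (i : Unit ⊕ Fin n ⊕ Fin n) (ψ : 𝓢(Rn n, ℂ)) :
    HasDerivWithinAt (fun s => 𝓕 (vec τ (u s) (ut s) (utt s) i) ψ)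
      (∑ j, 𝓕 (vec τ (u t) (ut t) (utt t) j)
        (SchwartzMap.smulLeftCLM ℂ (fun ξ => freqSymbol τ (β - τ) ξ i j) ψ)) (Set.Ici 0) t := by
  rw [← fourier_vecDeriv_apply hτ]
  exact hasDerivWithinAt_vec h t ht i (𝓕 ψ)

end Equation

end MGT

namespace MGT

/-! ### `L^p` representatives and Bernstein's inequality. -/

section Bernstein

open MeasureTheory
open scoped Topology FourierTransform

lemma integral_smul_toSchwartz {n : ℕ} {f : Rn n → ℂ} {g : Rn n → ℝ}
    (hg : ContDiff ℝ ((⊤ : ℕ∞) : WithTop ℕ∞) g) (hc : HasCompactSupport g) :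
    ∃ ψ : 𝓢(Rn n, ℂ), (∀ x, ψ x = g x) ∧ ∫ x, g x • f x = ∫ x, ψ x * f x := by
  have hg₁ : HasCompactSupport (Complex.ofRealCLM ∘ g) := hc.comp_left rfl
  have hg₂ : ContDiff ℝ ((⊤ : ℕ∞) : WithTop ℕ∞) (Complex.ofRealCLM ∘ g) :=
    Complex.ofRealCLM.contDiff.comp hg
  exact ⟨hg₁.toSchwartzMap hg₂, fun x => rfl, by simp⟩

lemma ae_eq_of_forall_integral_schwartz_eq {n : ℕ} {f g : Rn n → ℂ}
    (hf : LocallyIntegrable f) (hg : LocallyIntegrable g)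
    (h : ∀ ψ : 𝓢(Rn n, ℂ), ∫ x, ψ x * f x = ∫ x, ψ x * g x) : f =ᵐ[volume] g := by
  refine ae_eq_of_integral_contDiff_smul_eq hf hg fun φ hφ hc => ?_
  obtain ⟨ψ, hψ, h1⟩ := integral_smul_toSchwartz (f := f) hφ hc
  obtain ⟨ψ', hψ', h2⟩ := integral_smul_toSchwartz (f := g) hφ hc
  have : ψ = ψ' := by ext x; rw [hψ, hψ']
  rw [h1, h2, ← this, h]

lemma lpNorm_eq_of_isRepresentedBy {n : ℕ} {p : ℝ≥0∞} (hp : 1 ≤ p) {T : 𝓢'(Rn n, ℂ)}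
    {g : Rn n → ℂ} (hg : IsRepresentedBy p T g) : lpNorm p T = eLpNorm g p volume := by
  refine le_antisymm (iInf₂_le g hg) (le_iInf₂ fun g' hg' => le_of_eq ?_)
  refine eLpNorm_congr_ae (ae_eq_of_forall_integral_schwartz_eq (hg.1.locallyIntegrable hp)
    (hg'.1.locallyIntegrable hp) fun ψ => ?_)
  rw [← hg.2, ← hg'.2]

/-- Interpolation between `L²` and `L^∞`, from `|f|^p ≤ M^{p-2} |f|²`. -/
lemma eLpNorm_le_of_ae_bound_of_two {α : Type*} [MeasurableSpace α] {μ : Measure α} {f : α → ℂ}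
    {p : ℝ} (hp : 2 ≤ p) {M : ℝ≥0∞} (hMtop : M ≠ ∞) (hM : ∀ᵐ x ∂μ, ‖f x‖ₑ ≤ M) :
    eLpNorm f (ENNReal.ofReal p) μ ≤ M ^ (1 - 2 / p) * eLpNorm f 2 μ ^ (2 / p) := by
  have hp0 : 0 < p := by linarith
  rw [eLpNorm_eq_lintegral_rpow_enorm_toReal (by simpa using hp0) ENNReal.ofReal_ne_top,
    eLpNorm_eq_lintegral_rpow_enorm_toReal (by simp) (by simp), ENNReal.toReal_ofReal hp0.le]
  have h1 : ∫⁻ x, ‖f x‖ₑ ^ p ∂μ ≤ M ^ (p - 2) * ∫⁻ x, ‖f x‖ₑ ^ (2 : ℝ) ∂μ := by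
    have h2 : ∫⁻ x, ‖f x‖ₑ ^ p ∂μ ≤ ∫⁻ x, M ^ (p - 2) * ‖f x‖ₑ ^ (2 : ℝ) ∂μ := by
      refine lintegral_mono_ae (hM.mono fun x hx => ?_)
      calc ‖f x‖ₑ ^ p = ‖f x‖ₑ ^ (p - 2) * ‖f x‖ₑ ^ (2 : ℝ) := by
            rw [← ENNReal.rpow_add_of_nonneg _ _ (by linarith) (by norm_num)]
            congr 1
            ring
        _ ≤ _ := by gcongr
    refine h2.trans ?_
    rw [lintegral_const_mul' _ _ (ENNReal.rpow_ne_top_of_nonneg (by linarith) hMtop)]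
  calc _ ≤ (M ^ (p - 2) * ∫⁻ x, ‖f x‖ₑ ^ (2 : ℝ) ∂μ) ^ (1 / p) := by gcongr
    _ = _ := by
      rw [ENNReal.mul_rpow_of_nonneg _ _ (by positivity), ← ENNReal.rpow_mul, ← ENNReal.rpow_mul]
      simp only [ENNReal.toReal_ofNat]
      congr 2
      · field_simp
      · field_simp

lemma eLpNorm_le_volume_mul_of_support {n : ℕ} {p q : ℝ≥0∞} (hpq : p ≤ q) {ρ : ℝ}
    {Y : Rn n → ℂ} (hY : AEStronglyMeasurable Y volume) (hs : ∀ ξ, Y ξ ≠ 0 → ‖ξ‖ ≤ ρ) :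
    eLpNorm Y p volume ≤ eLpNorm Y q volume *
      volume (Metric.closedBall (0 : Rn n) ρ) ^ (1 / p.toReal - 1 / q.toReal) := by
  have hsub : Function.support Y ⊆ Metric.closedBall (0 : Rn n) ρ := fun ξ hξ => by
    simpa using hs ξ hξ
  have h := eLpNorm_le_eLpNorm_mul_rpow_measure_univ hpq
    (μ := volume.restrict (Metric.closedBall (0 : Rn n) ρ)) hY.restrict
  rwa [eLpNorm_restrict_eq_of_support_subset hsub, eLpNorm_restrict_eq_of_support_subset hsub,
    Measure.restrict_apply_univ] at h

/-- Bernstein's inequality: the inverse Fourier transform `h` of an `L²` function supported in a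
ball is in `L^p`. -/
lemma exists_fourierInv_of_support {n : ℕ} {p : ℝ} (hp : 2 ≤ p) {ρ : ℝ} {Y : Rn n → ℂ}
    (hY : MemLp Y 2 volume) (hs : ∀ ξ, Y ξ ≠ 0 → ‖ξ‖ ≤ ρ) :
    ∃ h : Rn n → ℂ, MemLp h (ENNReal.ofReal p) volume ∧
      (∀ ψ : 𝓢(Rn n, ℂ), ∫ x, 𝓕 ψ x * h x = ∫ ξ, ψ ξ * Y ξ) ∧
      eLpNorm h (ENNReal.ofReal p) volume ≤
        volume (Metric.closedBall (0 : Rn n) ρ) ^ (1 / 2 - 1 / p) * eLpNorm Y 2 volume := by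
  have hp0 : 0 < p := by linarith
  set V : ℝ≥0∞ := volume (Metric.closedBall (0 : Rn n) ρ) with hV
  have hVtop : V ≠ ∞ := (isCompact_closedBall _ _).measure_lt_top.ne
  have hY1le : eLpNorm Y 1 volume ≤ eLpNorm Y 2 volume * V ^ (1 / 2 : ℝ) := by
    have := eLpNorm_le_volume_mul_of_support (p := 1) (q := 2) (by norm_num) hY.1 hs
    norm_num at this
    exact this
  have hY1 : MemLp Y 1 volume := ⟨hY.1, hY1le.trans_lt (ENNReal.mul_lt_top hY.2
    (ENNReal.rpow_lt_top_of_nonneg (by norm_num) hVtop))⟩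
  have hYint : Integrable Y := memLp_one_iff_integrable.1 hY1
  -- Two inverse transforms of `Y`: the convergent integral `h₀` gives the sup bound by `‖Y‖₁`, the
  -- `L²` transform `f` gives Plancherel. They pair equally with Schwartz functions, so they agree
  -- almost everywhere.
  let h₀ : Rn n → ℂ := VectorFourier.fourierIntegral Real.fourierChar volume (-innerₗ (Rn n)) Y
  let f : Lp ℂ 2 (volume : Measure (Rn n)) := 𝓕⁻ (hY.toLp Y)
  have hfT : ∀ ψ : 𝓢(Rn n, ℂ), ∫ x, ψ x * f x = ∫ ξ, 𝓕⁻ ψ ξ * Y ξ := by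
    intro ψ
    have h1 := congrArg (fun T : 𝓢'(Rn n, ℂ) => T ψ)
      (Lp.fourierInv_toTemperedDistribution_eq (hY.toLp Y))
    simp only [TemperedDistribution.fourierInv_apply, Lp.toTemperedDistribution_apply,
      smul_eq_mul] at h1
    rw [← h1]
    refine integral_congr_ae ?_
    filter_upwards [hY.coeFn_toLp] with x hx
    rw [hx]
  have hL : Continuous fun p : Rn n × Rn n => (-innerₗ (Rn n)) p.1 p.2 := by
    simp only [LinearMap.neg_apply, innerₗ_apply_apply]
    fun_prop
  have hflip : (-innerₗ (Rn n)).flip = -innerₗ (Rn n) := by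
    ext x y
    simp [real_inner_comm]
  have hh₀T : ∀ ψ : 𝓢(Rn n, ℂ), ∫ x, ψ x * h₀ x = ∫ ξ, 𝓕⁻ ψ ξ * Y ξ := by
    intro ψ
    have h1 := VectorFourier.integral_fourierIntegral_smul_eq_flip (L := -innerₗ (Rn n))
      (μ := volume) (ν := volume) (e := Real.fourierChar) Real.continuous_fourierChar hL
      ψ.integrable hYint
    rw [hflip] at h1
    simp only [smul_eq_mul] at h1
    rw [SchwartzMap.fourierInv_coe]
    exact h1.symm
  have hh₀c : Continuous h₀ :=
    VectorFourier.fourierIntegral_continuous Real.continuous_fourierChar hL hYint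
  have hae : (f : Rn n → ℂ) =ᵐ[volume] h₀ :=
    ae_eq_of_forall_integral_schwartz_eq ((Lp.memLp f).locallyIntegrable (by norm_num))
      hh₀c.locallyIntegrable fun ψ => by rw [hfT, hh₀T]
  have hbd : ∀ᵐ x, ‖f x‖ₑ ≤ eLpNorm Y 1 volume := by
    filter_upwards [hae] with x hx
    rw [hx]
    have h1 := VectorFourier.norm_fourierIntegral_le_integral_norm Real.fourierChar volume
      (-innerₗ (Rn n)) Y x
    rw [eLpNorm_one_eq_lintegral_enorm, ← ofReal_integral_norm_eq_lintegral_enorm hYint,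
      ← ofReal_norm]
    exact ENNReal.ofReal_le_ofReal h1
  have hf2 : eLpNorm f 2 volume = eLpNorm Y 2 volume := by
    have h1 : ‖f‖ = ‖hY.toLp Y‖ := (Lp.fourierTransformₗᵢ (Rn n) ℂ).symm.norm_map _
    rw [← eLpNorm_congr_ae hY.coeFn_toLp]
    have := congrArg ENNReal.ofReal h1
    rwa [Lp.norm_def, Lp.norm_def, ENNReal.ofReal_toReal (Lp.eLpNorm_ne_top _),
      ENNReal.ofReal_toReal (Lp.eLpNorm_ne_top _)] at this
  have hnorm : eLpNorm f (ENNReal.ofReal p) volume ≤ V ^ (1 / 2 - 1 / p) * eLpNorm Y 2 volume := by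
    have h2p : 2 / p ≤ 1 := by rw [div_le_one hp0]; exact hp
    calc _ ≤ eLpNorm Y 1 volume ^ (1 - 2 / p) * eLpNorm f 2 volume ^ (2 / p) :=
          eLpNorm_le_of_ae_bound_of_two hp hY1.2.ne hbd
      _ ≤ (eLpNorm Y 2 volume * V ^ (1 / 2 : ℝ)) ^ (1 - 2 / p) *
            eLpNorm Y 2 volume ^ (2 / p) := by
          rw [hf2]
          gcongr
      _ = V ^ (1 / 2 - 1 / p) * (eLpNorm Y 2 volume ^ (1 - 2 / p) *
            eLpNorm Y 2 volume ^ (2 / p)) := by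
          rw [ENNReal.mul_rpow_of_nonneg _ _ (by linarith), ← ENNReal.rpow_mul]
          have : 1 / 2 * (1 - 2 / p) = 1 / 2 - 1 / p := by ring
          rw [this]
          ring
      _ = _ := by
          rw [← ENNReal.rpow_add_of_nonneg _ _ (by linarith) (by positivity)]
          simp
  refine ⟨f, ⟨(Lp.memLp f).1, hnorm.trans_lt (ENNReal.mul_lt_top
    (ENNReal.rpow_lt_top_of_nonneg ?_ hVtop) hY.2)⟩, fun ψ => ?_, hnorm⟩
  · have : 1 / p ≤ 1 / 2 := one_div_le_one_div_of_le (by norm_num) hp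
    linarith
  · rw [hfT, FourierTransform.fourierInv_fourier_eq]

end Bernstein

/-! ### Dyadic blocks as functions on annuli. -/

section Decomposition

open MeasureTheory
open scoped Topology FourierTransform

/-- The frequencies in the support of the `j`-th dyadic block. -/
def annulus (n : ℕ) (j : ℤ) : Set (Rn n) :=
  {ξ | 3 / 4 * (2 : ℝ) ^ j ≤ 2 * Real.pi * ‖ξ‖ ∧ 2 * Real.pi * ‖ξ‖ ≤ 8 / 3 * (2 : ℝ) ^ j}

lemma isClosed_annulus (n : ℕ) (j : ℤ) : IsClosed (annulus n j) := by
  have h : Continuous fun ξ : Rn n => 2 * Real.pi * ‖ξ‖ := by fun_prop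
  exact IsClosed.inter (isClosed_le continuous_const h) (isClosed_le h continuous_const)

/-- The symbol of the `j`-th dyadic block. -/
def blockSymbol {n : ℕ} (P : DyadicPartition n) (j : ℤ) (ξ : Rn n) : ℂ :=
  ((P.φ (((2 : ℝ) ^ (-j) * (2 * Real.pi)) • ξ) : ℝ) : ℂ)

lemma blockSymbol_eq_zero {n : ℕ} (P : DyadicPartition n) (j : ℤ) {ξ : Rn n}
    (hξ : ξ ∉ annulus n j) : blockSymbol P j ξ = 0 := by
  by_contra h
  have h1 : P.φ (((2 : ℝ) ^ (-j) * (2 * Real.pi)) • ξ) ≠ 0 := fun h0 => h (by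
    rw [blockSymbol, h0, Complex.ofReal_zero])
  have h2 := P.support_subset h1
  have h3 : (0 : ℝ) < 2 ^ j := by positivity
  have h4 : ‖((2 : ℝ) ^ (-j) * (2 * Real.pi)) • ξ‖ = 2 * Real.pi * ‖ξ‖ / 2 ^ j := by
    rw [norm_smul, Real.norm_of_nonneg (by positivity), zpow_neg]
    field_simp
  simp only [Set.mem_ofPred_eq, h4, le_div_iff₀ h3, div_le_iff₀ h3] at h2
  exact hξ h2

lemma hasTemperateGrowth_blockSymbol {n : ℕ} (P : DyadicPartition n) (j : ℤ) :
    (blockSymbol P j).HasTemperateGrowth := by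
  refine HasCompactSupport.hasTemperateGrowth ?_ ?_
  · refine HasCompactSupport.of_support_subset_isCompact
      (isCompact_closedBall (0 : Rn n) (8 / 3 * (2 : ℝ) ^ j)) fun ξ hξ => ?_
    have h1 : ξ ∈ annulus n j := by
      by_contra h
      exact hξ (blockSymbol_eq_zero P j h)
    rw [mem_closedBall_zero_iff]
    have h2 := h1.2
    have h3 : 1 ≤ 2 * Real.pi := by linarith [Real.pi_gt_three]
    nlinarith [norm_nonneg ξ]
  · exact Complex.ofRealCLM.contDiff.comp (P.smooth.comp (contDiff_const_smul _))

lemma fourier_block_apply {n : ℕ} (P : DyadicPartition n) (j : ℤ) (f : 𝓢'(Rn n, ℂ))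
    (ψ : 𝓢(Rn n, ℂ)) :
    𝓕 (block P j f) ψ = 𝓕 f (SchwartzMap.smulLeftCLM ℂ (blockSymbol P j) ψ) := by
  have : 𝓕 (block P j f) = TemperedDistribution.smulLeftCLM ℂ (blockSymbol P j) (𝓕 f) := by
    rw [block, TemperedDistribution.fourierMultiplierCLM_apply,
      FourierTransform.fourier_fourierInv_eq]
    rfl
  rw [this, TemperedDistribution.smulLeftCLM_apply_apply]

/-- A dyadic block in `L²` is, in Fourier variables, an `L²` function supported in an annulus. -/
lemma exists_fourier_block {n : ℕ} (P : DyadicPartition n) (j : ℤ) (f : 𝓢'(Rn n, ℂ))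
    (hf : lpNorm 2 (block P j f) ≠ ∞) :
    ∃ G : Rn n → ℂ, StronglyMeasurable G ∧ (∀ ξ, G ξ ≠ 0 → ξ ∈ annulus n j) ∧
      eLpNorm G 2 volume = lpNorm 2 (block P j f) ∧
      ∀ ψ : 𝓢(Rn n, ℂ), 𝓕 (block P j f) ψ = ∫ ξ, ψ ξ * G ξ := by
  obtain ⟨g, hg⟩ : ∃ g, IsRepresentedBy 2 (block P j f) g := by
    by_contra h
    push Not at h
    exact hf (by simp [lpNorm, h])
  let F : Lp ℂ 2 (volume : Measure (Rn n)) := 𝓕 (hg.1.toLp g)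
  have hT : block P j f = Lp.toTemperedDistribution (hg.1.toLp g) := by
    ext ψ
    rw [hg.2, Lp.toTemperedDistribution_apply]
    refine integral_congr_ae ?_
    filter_upwards [hg.1.coeFn_toLp] with x hx
    rw [hx, smul_eq_mul]
  have hF : ∀ ψ : 𝓢(Rn n, ℂ), 𝓕 (block P j f) ψ = ∫ ξ, ψ ξ * F ξ := by
    intro ψ
    rw [hT, Lp.fourier_toTemperedDistribution_eq, Lp.toTemperedDistribution_apply]
    rfl
  -- A test function supported off the annulus is killed by `blockSymbol P j`.
  have hzero : ∀ᵐ ξ, ξ ∈ (annulus n j)ᶜ → F ξ = 0 := by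
    refine (isClosed_annulus n j).isOpen_compl.ae_eq_zero_of_integral_contDiff_smul_eq_zero
      (((Lp.memLp F).locallyIntegrable (by norm_num)).locallyIntegrableOn _) fun φ hφ hc hsub => ?_
    obtain ⟨ψ, hψ, h1⟩ := integral_smul_toSchwartz (f := F) hφ hc
    rw [h1, ← hF, fourier_block_apply]
    have : SchwartzMap.smulLeftCLM ℂ (blockSymbol P j) ψ = 0 := by
      ext ξ
      rw [SchwartzMap.smulLeftCLM_apply_apply (hasTemperateGrowth_blockSymbol P j)]
      by_cases hξ : ξ ∈ annulus n j
      · have : ψ ξ = 0 := by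
          rw [hψ, image_eq_zero_of_notMem_tsupport fun h => hsub h hξ]
          simp
        simp [this]
      · simp [blockSymbol_eq_zero P j hξ]
    rw [this, map_zero]
  -- Passing to the indicator makes the support condition hold at every point, as the later
  -- pointwise bounds require.
  have hae : (annulus n j).indicator F =ᵐ[volume] F := by
    filter_upwards [hzero] with ξ hξ
    by_cases h : ξ ∈ annulus n j
    · simp [h]
    · simp [h, hξ h]
  refine ⟨(annulus n j).indicator F, (Lp.stronglyMeasurable F).indicator
    (isClosed_annulus n j).measurableSet, fun ξ hξ => Set.mem_of_indicator_ne_zero hξ, ?_,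
    fun ψ => ?_⟩
  · rw [eLpNorm_congr_ae hae, lpNorm_eq_of_isRepresentedBy (by norm_num) hg,
      ← eLpNorm_congr_ae hg.1.coeFn_toLp]
    have h1 : ‖F‖ = ‖hg.1.toLp g‖ := Lp.norm_fourier_eq _
    have := congrArg ENNReal.ofReal h1
    rwa [Lp.norm_def, Lp.norm_def, ENNReal.ofReal_toReal (Lp.eLpNorm_ne_top _),
      ENNReal.ofReal_toReal (Lp.eLpNorm_ne_top _)] at this
  · rw [hF]
    refine integral_congr_ae ?_
    filter_upwards [hae] with ξ hξ
    rw [hξ]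

end Decomposition

end MGT

namespace MGT

/-! ### Dyadic sums and the decay rate in time. -/

section DyadicSums

open Filter

/-- This is `y ≤ e^y` at `y = cx/γ`, raised to the power `γ`. -/
lemma exp_neg_mul_le {c γ x : ℝ} (hc : 0 < c) (hγ : 0 < γ) (hx : 0 < x) :
    Real.exp (-(c * x)) ≤ (γ / c) ^ γ * x ^ (-γ) := by
  have h1 : c * x / γ ≤ Real.exp (c * x / γ) := by linarith [Real.add_one_le_exp (c * x / γ)]
  have h2 : (c * x / γ) ^ γ ≤ Real.exp (c * x) := by
    calc _ ≤ Real.exp (c * x / γ) ^ γ := Real.rpow_le_rpow (by positivity) h1 hγ.le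
      _ = Real.exp (c * x) := by
        rw [← Real.exp_mul]
        congr 1
        field_simp
  have h3 : (0 : ℝ) < (c * x / γ) ^ γ := by positivity
  rw [Real.exp_neg]
  calc _ ≤ ((c * x / γ) ^ γ)⁻¹ := inv_anti₀ h3 h2
    _ = _ := by
      rw [← Real.inv_rpow (by positivity), Real.rpow_neg hx.le, ← Real.inv_rpow hx.le,
        ← Real.mul_rpow (by positivity) (by positivity)]
      congr 1
      field_simp

lemma four_zpow_rpow (j : ℤ) (a : ℝ) : ((4 : ℝ) ^ j) ^ a = (2 : ℝ) ^ ((j : ℝ) * (2 * a)) := by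
  have : (4 : ℝ) ^ j = (2 : ℝ) ^ ((j : ℝ) * 2) := by
    rw [mul_comm, Real.rpow_mul (by norm_num), Real.rpow_intCast]
    norm_num
  rw [this, ← Real.rpow_mul (by norm_num)]
  congr 1
  ring

lemma summable_dyadic_exp {c α : ℝ} (hc : 0 < c) (hα : 0 < α) :
    Summable fun j : ℤ => (2 : ℝ) ^ ((j : ℝ) * α) * Real.exp (-(c * (4 : ℝ) ^ j)) := by
  have hgeo : Summable fun m : ℕ => ((2 : ℝ) ^ (-α)) ^ m :=
    summable_geometric_of_lt_one (by positivity) (Real.rpow_lt_one_of_one_lt_of_neg (by norm_num)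
      (by linarith))
  have hpow : ∀ m : ℕ, ((2 : ℝ) ^ (-α)) ^ m = (2 : ℝ) ^ (-(m * α)) := by
    intro m
    rw [← Real.rpow_natCast, ← Real.rpow_mul (by norm_num)]
    congr 1
    ring
  refine Summable.of_nat_of_neg ?_ ?_
  · refine Summable.of_nonneg_of_le (fun m => by positivity) (fun m => ?_)
      (hgeo.mul_left ((α / c) ^ α))
    have h1 := exp_neg_mul_le hc hα (x := (4 : ℝ) ^ (m : ℤ)) (by positivity)
    rw [four_zpow_rpow] at h1
    rw [hpow]
    calc _ ≤ (2 : ℝ) ^ (((m : ℤ) : ℝ) * α) *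
          ((α / c) ^ α * (2 : ℝ) ^ (((m : ℤ) : ℝ) * (2 * -α))) := by gcongr
      _ = (α / c) ^ α * ((2 : ℝ) ^ (((m : ℤ) : ℝ) * α) *
          (2 : ℝ) ^ (((m : ℤ) : ℝ) * (2 * -α))) := by ring
      _ = _ := by
        rw [← Real.rpow_add (by norm_num)]
        congr 2
        push_cast
        ring
  · refine Summable.of_nonneg_of_le (fun m => by positivity) (fun m => ?_) hgeo
    rw [hpow]
    calc _ ≤ (2 : ℝ) ^ (((-(m : ℤ) : ℤ) : ℝ) * α) * 1 := by
          gcongr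
          rw [Real.exp_le_one_iff, neg_nonpos]
          positivity
      _ = _ := by
          rw [mul_one]
          congr 1
          push_cast
          ring

/-- Scaling: for `4^k ≤ T < 4^{k+1}`, shifting the index by `k` reduces to `T = 1` and produces the
factor `2^{-kα}`, comparable to `T^{-α/2}`. -/
lemma tsum_dyadic_exp_le {c α : ℝ} (hc : 0 < c) (hα : 0 < α) : ∃ C : ℝ, 0 < C ∧
    ∀ T : ℝ, 0 < T → ∑' j : ℤ, ENNReal.ofReal ((2 : ℝ) ^ ((j : ℝ) * α) *
      Real.exp (-(c * (4 : ℝ) ^ j * T))) ≤ ENNReal.ofReal (C * T ^ (-(α / 2))) := by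
  have hs := summable_dyadic_exp hc hα
  set S := ∑' j : ℤ, (2 : ℝ) ^ ((j : ℝ) * α) * Real.exp (-(c * (4 : ℝ) ^ j)) with hS
  have hS0 : 0 ≤ S := tsum_nonneg fun j => by positivity
  refine ⟨2 ^ α * (S + 1), by positivity, fun T hT => ?_⟩
  obtain ⟨k, hk1, hk2⟩ := exists_mem_Ico_zpow hT (by norm_num : (1 : ℝ) < 4)
  rw [← (Equiv.subRight k).tsum_eq]
  have hterm : ∀ j : ℤ, (2 : ℝ) ^ (((j - k : ℤ) : ℝ) * α) *
      Real.exp (-(c * (4 : ℝ) ^ (j - k) * T)) ≤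
      (2 : ℝ) ^ (-(k * α)) * ((2 : ℝ) ^ ((j : ℝ) * α) * Real.exp (-(c * (4 : ℝ) ^ j))) := by
    intro j
    rw [← mul_assoc, ← Real.rpow_add (by norm_num)]
    have e : ((j - k : ℤ) : ℝ) * α = -(k * α) + (j : ℝ) * α := by push_cast; ring
    rw [e]
    have h4 : (4 : ℝ) ^ j = (4 : ℝ) ^ (j - k) * (4 : ℝ) ^ k := by
      rw [← zpow_add₀ (by norm_num)]
      congr 1
      ring
    have h6 : c * (4 : ℝ) ^ j ≤ c * (4 : ℝ) ^ (j - k) * T := by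
      rw [h4, ← mul_assoc]
      exact mul_le_mul_of_nonneg_left hk1 (by positivity)
    exact mul_le_mul_of_nonneg_left (Real.exp_le_exp.2 (neg_le_neg h6)) (by positivity)
  have hk : (2 : ℝ) ^ (-(k * α)) ≤ 2 ^ α * T ^ (-(α / 2)) := by
    have h5 : T ^ (α / 2) ≤ (2 : ℝ) ^ (((k + 1 : ℤ) : ℝ) * α) := by
      calc T ^ (α / 2) ≤ ((4 : ℝ) ^ (k + 1)) ^ (α / 2) :=
            Real.rpow_le_rpow hT.le hk2.le (by positivity)
        _ = _ := by
            rw [four_zpow_rpow]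
            congr 1
            ring
    rw [Real.rpow_neg hT.le, ← div_eq_mul_inv, le_div_iff₀ (by positivity)]
    calc _ ≤ (2 : ℝ) ^ (-(k * α)) * (2 : ℝ) ^ (((k + 1 : ℤ) : ℝ) * α) := by gcongr
      _ = 2 ^ α := by
          rw [← Real.rpow_add (by norm_num)]
          congr 1
          push_cast
          ring
  calc _ ≤ ∑' j : ℤ, ENNReal.ofReal ((2 : ℝ) ^ (-(k * α)) *
        ((2 : ℝ) ^ ((j : ℝ) * α) * Real.exp (-(c * (4 : ℝ) ^ j)))) :=
        ENNReal.tsum_le_tsum fun j => ENNReal.ofReal_le_ofReal (hterm j)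
    _ = ENNReal.ofReal ((2 : ℝ) ^ (-(k * α)) * S) := by
        rw [hS, ← tsum_mul_left, ENNReal.ofReal_tsum_of_nonneg (fun j => by positivity)
          (hs.mul_left _)]
    _ ≤ _ := by
        refine ENNReal.ofReal_le_ofReal ?_
        calc _ ≤ 2 ^ α * T ^ (-(α / 2)) * (S + 1) := by
              gcongr
              linarith
          _ = _ := by ring

/-- The weight `4 ^ j / (2 + 4 ^ j)` is the decay rate in the `j`-th annulus. -/
lemma exp_rate_le {c t : ℝ} (hc : 0 < c) (ht : 0 ≤ t) (j : ℤ) :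
    (0 ≤ j → Real.exp (-(c * ((4 : ℝ) ^ j / (2 + 4 ^ j))) * t) ≤ Real.exp (-(c / 3 * t))) ∧
    (j ≤ 0 → Real.exp (-(c * ((4 : ℝ) ^ j / (2 + 4 ^ j))) * t) ≤
      Real.exp (c / 3) * Real.exp (-(c / 3 * (4 : ℝ) ^ j * (1 + t)))) := by
  have h4 : (0 : ℝ) < 4 ^ j := by positivity
  constructor
  · intro hj
    have h1 : (1 : ℝ) ≤ 4 ^ j := one_le_zpow₀ (by norm_num) hj
    have h2 : (1 : ℝ) / 3 ≤ 4 ^ j / (2 + 4 ^ j) := by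
      rw [div_le_div_iff₀ (by norm_num) (by positivity)]
      linarith
    gcongr
    have h3 := mul_le_mul_of_nonneg_left h2 (mul_nonneg hc.le ht)
    nlinarith
  · intro hj
    have h1 : (4 : ℝ) ^ j ≤ 1 := zpow_le_one_of_nonpos₀ (by norm_num) hj
    have h2 : (4 : ℝ) ^ j / 3 ≤ 4 ^ j / (2 + 4 ^ j) := by
      gcongr
      linarith
    -- The factor `exp(c/3)` pays for replacing `t` by `1 + t`, since `4^j ≤ 1`.
    rw [← Real.exp_add]
    gcongr
    have h3 := mul_le_mul_of_nonneg_left h2 (mul_nonneg hc.le ht)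
    have h5 := mul_le_mul_of_nonneg_left h1 hc.le
    nlinarith

/-- For `j ≥ 0` the decay is exponential in `t`, better than any power, and the `ℓ¹` norm sums the
blocks. For `j ≤ 0` write `2^{js} N j = 2^{j(s+σ)} · 2^{-jσ} N j`, bound the last factor by the
supremum and sum the rest by `tsum_dyadic_exp_le`. -/
lemma tsum_weighted_decay_le {s σ c : ℝ} (hc : 0 < c) (hα : 0 < s + σ) : ∃ C : ℝ, 0 < C ∧
    ∀ (N : ℤ → ℝ≥0∞) (t : ℝ), 0 ≤ t →
      ∑' j : ℤ, ENNReal.ofReal ((2 : ℝ) ^ ((j : ℝ) * s)) *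
        (ENNReal.ofReal (Real.exp (-(c * ((4 : ℝ) ^ j / (2 + 4 ^ j))) * t)) * N j) ≤
      ENNReal.ofReal (C * (1 + t) ^ (-((s + σ) / 2))) *
        ((∑' j : ℤ, ENNReal.ofReal ((2 : ℝ) ^ ((j : ℝ) * s)) * N j) +
          ⨆ j : ℤ, ENNReal.ofReal ((2 : ℝ) ^ ((j : ℝ) * -σ)) * N j) := by
  set α := s + σ with hαdef
  have hc3 : 0 < c / 3 := by positivity
  have hα2 : 0 < α / 2 := by positivity
  obtain ⟨C₂, hC₂, h2⟩ := tsum_dyadic_exp_le hc3 hα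
  let C₁ : ℝ := Real.exp (c / 3) * (α / 2 / (c / 3)) ^ (α / 2)
  have hC₁ : 0 < C₁ := by positivity
  let C₃ : ℝ := Real.exp (c / 3) * C₂
  have hC₃ : 0 < C₃ := by positivity
  refine ⟨C₁ + C₃, by positivity, fun N t ht => ?_⟩
  have ht1 : 0 < 1 + t := by linarith
  set B₂ := ⨆ j : ℤ, ENNReal.ofReal ((2 : ℝ) ^ ((j : ℝ) * -σ)) * N j with hB₂
  set D := (1 + t) ^ (-(α / 2)) with hD
  have hD0 : 0 < D := by positivity
  have hterm : ∀ j : ℤ, ENNReal.ofReal ((2 : ℝ) ^ ((j : ℝ) * s)) *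
      (ENNReal.ofReal (Real.exp (-(c * ((4 : ℝ) ^ j / (2 + 4 ^ j))) * t)) * N j) ≤
      ENNReal.ofReal (C₁ * D) * (ENNReal.ofReal ((2 : ℝ) ^ ((j : ℝ) * s)) * N j) +
      ENNReal.ofReal (Real.exp (c / 3)) * (ENNReal.ofReal ((2 : ℝ) ^ ((j : ℝ) * α) *
        Real.exp (-(c / 3 * (4 : ℝ) ^ j * (1 + t)))) * B₂) := by
    intro j
    rcases le_total 0 j with hj | hj
    · refine le_add_right ?_
      have h3 : Real.exp (-(c * ((4 : ℝ) ^ j / (2 + 4 ^ j))) * t) ≤ C₁ * D := by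
        refine ((exp_rate_le hc ht j).1 hj).trans ?_
        have h4 := exp_neg_mul_le hc3 hα2 ht1
        have h5 : Real.exp (-(c / 3 * t)) = Real.exp (c / 3) * Real.exp (-(c / 3 * (1 + t))) := by
          rw [← Real.exp_add]
          congr 1
          ring
        rw [h5]
        calc _ ≤ Real.exp (c / 3) * ((α / 2 / (c / 3)) ^ (α / 2) * (1 + t) ^ (-(α / 2))) := by
              gcongr
          _ = C₁ * D := by simp only [C₁, hD]; ring
      calc _ ≤ ENNReal.ofReal ((2 : ℝ) ^ ((j : ℝ) * s)) * (ENNReal.ofReal (C₁ * D) * N j) := by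
            gcongr
        _ = _ := by ring
    · refine le_add_left ?_
      have h3 := (exp_rate_le hc ht j).2 hj
      have h4 : ENNReal.ofReal ((2 : ℝ) ^ ((j : ℝ) * -σ)) * N j ≤ B₂ :=
        le_iSup (fun j : ℤ => ENNReal.ofReal ((2 : ℝ) ^ ((j : ℝ) * -σ)) * N j) j
      have h5 : (2 : ℝ) ^ ((j : ℝ) * s) = (2 : ℝ) ^ ((j : ℝ) * α) * (2 : ℝ) ^ ((j : ℝ) * -σ) := by
        rw [← Real.rpow_add (by norm_num)]
        congr 1
        rw [hαdef]
        ring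
      calc _ ≤ ENNReal.ofReal ((2 : ℝ) ^ ((j : ℝ) * s)) *
            (ENNReal.ofReal (Real.exp (c / 3) *
              Real.exp (-(c / 3 * (4 : ℝ) ^ j * (1 + t)))) * N j) := by gcongr
        _ = ENNReal.ofReal (Real.exp (c / 3)) * (ENNReal.ofReal ((2 : ℝ) ^ ((j : ℝ) * α) *
              Real.exp (-(c / 3 * (4 : ℝ) ^ j * (1 + t)))) *
              (ENNReal.ofReal ((2 : ℝ) ^ ((j : ℝ) * -σ)) * N j)) := by
            rw [h5, ENNReal.ofReal_mul (by positivity), ENNReal.ofReal_mul (by positivity),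
              ENNReal.ofReal_mul (by positivity)]
            ring
        _ ≤ _ := by gcongr
  refine (ENNReal.tsum_le_tsum hterm).trans ?_
  rw [ENNReal.tsum_add, ENNReal.tsum_mul_left, ENNReal.tsum_mul_left, ENNReal.tsum_mul_right]
  have h6 := h2 (1 + t) ht1
  have h7 : ENNReal.ofReal (Real.exp (c / 3)) * ENNReal.ofReal (C₂ * (1 + t) ^ (-(α / 2))) =
      ENNReal.ofReal (C₃ * D) := by
    rw [← ENNReal.ofReal_mul (by positivity)]
    congr 1
    simp only [C₃, hD]
    ring
  rw [mul_add]
  refine add_le_add ?_ ?_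
  · gcongr
    linarith
  · rw [← mul_assoc]
    gcongr
    calc _ ≤ ENNReal.ofReal (Real.exp (c / 3)) * ENNReal.ofReal (C₂ * (1 + t) ^ (-(α / 2))) := by
          gcongr
      _ = ENNReal.ofReal (C₃ * D) := h7
      _ ≤ _ := by
          gcongr
          linarith

end DyadicSums

/-! ### Estimates on a single annulus. -/

section BlockEstimates

open MeasureTheory
open scoped Topology FourierTransform

lemma volume_closedBall_rpow {n : ℕ} (j : ℤ) {e : ℝ} (he : 0 ≤ e) :
    volume (Metric.closedBall (0 : Rn n) ((2 : ℝ) ^ j)) ^ e =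
      ENNReal.ofReal ((2 : ℝ) ^ ((j : ℝ) * (n * e))) * volume (Metric.ball (0 : Rn n) 1) ^ e := by
  have h2 : (0 : ℝ) ≤ 2 ^ j := by positivity
  rw [Measure.addHaar_closedBall _ _ h2, ENNReal.mul_rpow_of_nonneg _ _ he,
    finrank_euclideanSpace_fin, ENNReal.ofReal_rpow_of_nonneg (pow_nonneg h2 _) he]
  congr 2
  rw [← Real.rpow_natCast, ← Real.rpow_mul h2, ← Real.rpow_intCast,
    ← Real.rpow_mul (by norm_num)]

lemma norm_le_of_mem_annulus {n : ℕ} {j : ℤ} {ξ : Rn n} (hξ : ξ ∈ annulus n j) :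
    ‖ξ‖ ≤ (2 : ℝ) ^ j := by
  have h2 := hξ.2
  have h3 : 6 ≤ 2 * Real.pi := by linarith [Real.pi_gt_three]
  have h4 : (0 : ℝ) < 2 ^ j := by positivity
  nlinarith [norm_nonneg ξ]

/-- On the annulus `|η|² ≥ (9/16) 4^j ≥ 4^j/2`, and `x/(1+x)` is increasing. -/
lemma rate_le_of_mem_annulus {n : ℕ} {j : ℤ} {ξ : Rn n} (hξ : ξ ∈ annulus n j) :
    (4 : ℝ) ^ j / (2 + 4 ^ j) ≤
      (∑ k, (2 * Real.pi * ξ k) ^ 2) / (1 + ∑ k, (2 * Real.pi * ξ k) ^ 2) := by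
  have h1 : ∑ k, (2 * Real.pi * ξ k) ^ 2 = (2 * Real.pi * ‖ξ‖) ^ 2 := by
    simp_rw [mul_pow _ (ξ _), ← Finset.mul_sum, mul_pow _ ‖ξ‖, EuclideanSpace.norm_sq_eq,
      Real.norm_eq_abs, sq_abs]
  have h4 : (4 : ℝ) ^ j = (2 ^ j) ^ 2 := by
    rw [← zpow_natCast, ← zpow_mul, mul_comm, zpow_mul]
    norm_num
  have h5 : (4 : ℝ) ^ j / 2 ≤ (2 * Real.pi * ‖ξ‖) ^ 2 := by
    have h6 := pow_le_pow_left₀ (by positivity) hξ.1 2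
    rw [h4]
    nlinarith [sq_nonneg ((2 : ℝ) ^ j)]
  have h7 : (0 : ℝ) < 4 ^ j := by positivity
  rw [h1, div_le_div_iff₀ (by positivity) (by positivity)]
  nlinarith

/-- Hölder on the ball, then `L²` against `L^p` there. The volume factor matches the Besov weight,
so a datum in `Ḃ^{n(1/2-1/p)}_{2,1}` has absolutely summable pairings over `j`. -/
lemma lintegral_mul_le_of_support {n : ℕ} {p : ℝ} (hp : 2 ≤ p) {ρ : ℝ} {G : Rn n → ℂ}
    (hG : AEStronglyMeasurable G volume) (hs : ∀ ξ, G ξ ≠ 0 → ‖ξ‖ ≤ ρ) (ψ : 𝓢(Rn n, ℂ)) :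
    ∫⁻ ξ, ‖ψ ξ * G ξ‖ₑ ≤ eLpNorm ψ (ENNReal.ofReal p) volume *
      (volume (Metric.closedBall (0 : Rn n) ρ) ^ (1 / 2 - 1 / p) * eLpNorm G 2 volume) := by
  set B := Metric.closedBall (0 : Rn n) ρ with hB
  have hp0 : 0 < p := by linarith
  have hψm : AEStronglyMeasurable (B.indicator ψ) volume :=
    ψ.continuous.aestronglyMeasurable.indicator Metric.isClosed_closedBall.measurableSet
  have h1 : ∀ ξ, ψ ξ * G ξ = B.indicator ψ ξ * G ξ := by
    intro ξ
    by_cases hξ : ξ ∈ B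
    · simp [hξ]
    · have : G ξ = 0 := by
        by_contra h
        exact hξ (by simpa [hB] using hs ξ h)
      simp [this]
  have h2 : eLpNorm (B.indicator ψ) 2 volume ≤
      eLpNorm (B.indicator ψ) (ENNReal.ofReal p) volume * volume B ^ (1 / 2 - 1 / p) := by
    have h3 := eLpNorm_le_volume_mul_of_support (p := 2) (q := ENNReal.ofReal p) (ρ := ρ)
      (by simpa using ENNReal.ofReal_le_ofReal hp) hψm (fun ξ hξ => by
        simpa [hB] using Set.mem_of_indicator_ne_zero hξ)
    rwa [ENNReal.toReal_ofNat, ENNReal.toReal_ofReal hp0.le] at h3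
  have h4 := eLpNorm_smul_le_mul_eLpNorm (p := 2) (q := 2) (r := 1) hG hψm
  rw [eLpNorm_one_eq_lintegral_enorm] at h4
  calc _ = ∫⁻ ξ, ‖(B.indicator ψ • G) ξ‖ₑ := by
        refine lintegral_congr fun ξ => ?_
        rw [h1]
        rfl
    _ ≤ eLpNorm (B.indicator ψ) 2 volume * eLpNorm G 2 volume := h4
    _ ≤ (eLpNorm (B.indicator ψ) (ENNReal.ofReal p) volume * volume B ^ (1 / 2 - 1 / p)) *
          eLpNorm G 2 volume := by gcongr
    _ ≤ (eLpNorm ψ (ENNReal.ofReal p) volume * volume B ^ (1 / 2 - 1 / p)) *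
          eLpNorm G 2 volume := by
        gcongr
        exact eLpNorm_indicator_le _
    _ = _ := by ring

end BlockEstimates

end MGT

namespace MGT

/-! ### Interchange of series, and recovery of `V(t)` in `L^p`. -/

section Reconstruction

open MeasureTheory
open scoped Topology FourierTransform

/-- The Taylor series in time can be summed under the sum over the dyadic pieces of the data. -/
lemma hasSum_integral_exp_mulVec {n : ℕ} {ι : Type*} [Fintype ι] [DecidableEq ι]
    {A : Rn n → Matrix ι ι ℂ} (hA : ∀ i j, (fun ξ => A ξ i j).HasTemperateGrowth)
    {T : ι → 𝓢(Rn n, ℂ) → ℂ} {G : ι → ℤ → Rn n → ℂ}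
    (hT : ∀ k χ, HasSum (fun j => ∫ ξ, χ ξ * G k j ξ) (T k χ))
    {ψ : 𝓢(Rn n, ℂ)} (hψ : HasCompactSupport ψ)
    (hint : ∀ k j, Integrable fun ξ => ψ ξ * G k j ξ)
    (hsum : ∀ k, Summable fun j => ∫ ξ, ‖ψ ξ * G k j ξ‖) (t : ℝ) (i : ι) {z : ℂ}
    (hz : HasSum (fun m : ℕ => ((t : ℂ) ^ m / m.factorial) *
      ∑ k, T k (SchwartzMap.smulLeftCLM ℂ (fun ξ => (A ξ ^ m) i k) ψ)) z) :
    HasSum (fun j => ∫ ξ, ψ ξ *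
      (NormedSpace.exp ((t : ℂ) • A ξ)).mulVec (fun k => G k j ξ) i) z := by
  have hpow := hasTemperateGrowth_matrix_pow hA
  -- Order `0` suffices here: it bounds the entries of `A^m` by `B^m` on the support of `ψ`.
  obtain ⟨B, hB0, hB⟩ := exists_norm_iteratedFDeriv_matrix_pow_le hA hψ 0
  have hbound : ∀ (m : ℕ) k j ξ, ‖(A ξ ^ m) i k * (ψ ξ * G k j ξ)‖ ≤
      B ^ m * ‖ψ ξ * G k j ξ‖ := by
    intro m k j ξ
    by_cases hξ : ξ ∈ tsupport ψ
    · rw [norm_mul]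
      have := hB m 0 i k le_rfl ξ hξ
      rw [norm_iteratedFDeriv_zero] at this
      gcongr
    · simp [image_eq_zero_of_notMem_tsupport hξ]
  have hint1 : ∀ (m : ℕ) k j, Integrable fun ξ => (A ξ ^ m) i k * (ψ ξ * G k j ξ) := by
    intro m k j
    refine Integrable.mono' ((hint k j).norm.const_mul (B ^ m)) ?_
      (Filter.Eventually.of_forall (hbound m k j))
    exact (hpow m i k).1.continuous.aestronglyMeasurable.mul (hint k j).1
  let f : ℕ → ℤ → Rn n → ℂ := fun m j ξ =>
    ((t : ℂ) ^ m / m.factorial) * ∑ k, (A ξ ^ m) i k * (ψ ξ * G k j ξ)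
  have hf : ∀ m j, Integrable (f m j) := fun m j =>
    (integrable_finsetSum _ fun k _ => hint1 m k j).const_mul _
  let g : ℤ → ℝ := fun j => ∑ k, ∫ ξ, ‖ψ ξ * G k j ξ‖
  have hg0 : ∀ j, 0 ≤ g j := fun j =>
    Finset.sum_nonneg fun k _ => integral_nonneg fun _ => norm_nonneg _
  have hg : Summable g := summable_sum fun k _ => hsum k
  let e : ℕ → ℝ := fun m => (|t| * B) ^ m / m.factorial
  have he : Summable e := Real.summable_pow_div_factorial _
  have hnorm : ∀ m j, ∫ ξ, ‖f m j ξ‖ ≤ e m * g j := by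
    intro m j
    have h1 : ∀ ξ, ‖f m j ξ‖ ≤ e m * ∑ k, ‖ψ ξ * G k j ξ‖ := by
      intro ξ
      simp only [f, e, norm_mul, norm_div, norm_pow, Complex.norm_natCast, Complex.norm_real,
        Real.norm_eq_abs, mul_pow]
      calc _ ≤ |t| ^ m / m.factorial * ∑ k, B ^ m * ‖ψ ξ * G k j ξ‖ := by
            gcongr
            exact (norm_sum_le _ _).trans (Finset.sum_le_sum fun k _ => hbound m k j ξ)
        _ = _ := by
            rw [← Finset.mul_sum]
            simp only [norm_mul]
            ring
    calc _ ≤ ∫ ξ, e m * ∑ k, ‖ψ ξ * G k j ξ‖ :=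
          integral_mono (hf m j).norm
            ((integrable_finsetSum _ fun k _ => (hint k j).norm).const_mul _) h1
      _ = e m * g j := by
          rw [integral_const_mul, integral_finsetSum _ fun k _ => (hint k j).norm]
  have hF : Summable fun x : ℕ × ℤ => ∫ ξ, f x.1 x.2 ξ := by
    refine Summable.of_norm_bounded (he.mul_of_nonneg hg (fun m => ?_) hg0) fun x =>
      (norm_integral_le_integral_norm _).trans (hnorm _ _)
    exact div_nonneg (pow_nonneg (mul_nonneg (abs_nonneg _) hB0) _) (Nat.cast_nonneg _)
  have hrow : ∀ m, HasSum (fun j => ∫ ξ, f m j ξ) (((t : ℂ) ^ m / m.factorial) *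
      ∑ k, T k (SchwartzMap.smulLeftCLM ℂ (fun ξ => (A ξ ^ m) i k) ψ)) := by
    intro m
    have h1 : ∀ j, ∫ ξ, f m j ξ = ((t : ℂ) ^ m / m.factorial) * ∑ k, ∫ ξ,
        (SchwartzMap.smulLeftCLM ℂ (fun ξ => (A ξ ^ m) i k) ψ) ξ * G k j ξ := by
      intro j
      simp only [f]
      rw [integral_const_mul, integral_finsetSum _ fun k _ => hint1 m k j]
      congr 1
      refine Finset.sum_congr rfl fun k _ => integral_congr_ae (Filter.Eventually.of_forall ?_)
      intro ξ
      simp only [SchwartzMap.smulLeftCLM_apply_apply (hpow _ _ _), smul_eq_mul, mul_assoc]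
    simp_rw [h1]
    exact (hasSum_sum fun k _ => hT k _).mul_left _
  have hcol : ∀ j, HasSum (fun m => ∫ ξ, f m j ξ) (∫ ξ, ψ ξ *
      (NormedSpace.exp ((t : ℂ) • A ξ)).mulVec (fun k => G k j ξ) i) := by
    intro j
    have h1 := hasSum_integral_of_summable_integral_norm (fun m => hf m j)
      (Summable.of_nonneg_of_le (fun m => integral_nonneg fun _ => norm_nonneg _)
        (fun m => hnorm m j) (he.mul_right (g j)))
    have h2 : ∀ ξ, ∑' m, f m j ξ = ψ ξ *
        (NormedSpace.exp ((t : ℂ) • A ξ)).mulVec (fun k => G k j ξ) i := by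
      intro ξ
      have h3 := hasSum_sum (s := Finset.univ) fun k _ =>
        (hasSum_exp_smul_apply (A ξ) t i k).mul_right (ψ ξ * G k j ξ)
      have h4 : (fun m => f m j ξ) = fun m : ℕ => ∑ k, (t : ℂ) ^ m / m.factorial * (A ξ ^ m) i k *
          (ψ ξ * G k j ξ) := by
        ext m
        simp only [f, Finset.mul_sum, mul_assoc]
      rw [h4, h3.tsum_eq, Matrix.mulVec, dotProduct, Finset.mul_sum]
      exact Finset.sum_congr rfl fun k _ => by ring
    simpa only [h2] using h1
  -- One absolutely convergent double series, summed first over the blocks and then first over the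
  -- Taylor index.
  have h1 := hF.hasSum.prod_fiberwise hrow
  have h2 := ((Equiv.prodComm ℤ ℕ).hasSum_iff.2 hF.hasSum).prod_fiberwise hcol
  rwa [h1.unique hz] at h2

/-- The series of the `h j` converges absolutely in `L^p`, and the Fourier transforms of `T` and of
its sum agree on compactly supported functions, hence everywhere. -/
lemma lpNorm_le_tsum {n : ℕ} {p : ℝ≥0∞} (hp : 1 ≤ p) {T : 𝓢'(Rn n, ℂ)} {h : ℤ → Rn n → ℂ}
    (hh : ∀ j, MemLp (h j) p volume) (hfin : ∑' j, eLpNorm (h j) p volume ≠ ∞)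
    (hT : ∀ ψ : 𝓢(Rn n, ℂ), HasCompactSupport ψ →
      HasSum (fun j => ∫ x, 𝓕 ψ x * h j x) (𝓕 T ψ)) :
    lpNorm p T ≤ ∑' j, eLpNorm (h j) p volume := by
  have : Fact (1 ≤ p) := ⟨hp⟩
  let H : ℤ → Lp ℂ p (volume : Measure (Rn n)) := fun j => (hh j).toLp (h j)
  have hH : ∀ j, ‖H j‖ₑ = eLpNorm (h j) p volume := fun j => Lp.enorm_toLp (hh j)
  have hs : Summable H := by
    refine Summable.of_norm ?_
    have := ENNReal.summable_toReal hfin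
    simpa only [← hH, toReal_enorm] using this
  set S := ∑' j, H j with hS
  have hrep : ∀ (F : Lp ℂ p (volume : Measure (Rn n))) (ψ : 𝓢(Rn n, ℂ)),
      Lp.toTemperedDistribution F ψ = ∫ x, ψ x * F x := by
    intro F ψ
    rw [Lp.toTemperedDistribution_apply]
    rfl
  have hTS : 𝓕 T - 𝓕 (Lp.toTemperedDistribution S) = 0 := by
    refine eq_zero_of_forall_compactSupport _ fun ψ hψ => ?_
    have h1 := (hs.hasSum.mapL (Lp.toTemperedDistributionCLM ℂ (volume : Measure (Rn n)) p)).mapL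
      (PointwiseConvergenceCLM.evalCLM (RingHom.id ℂ) ℂ (𝓕 ψ))
    have h2 : HasSum (fun j => ∫ x, 𝓕 ψ x * h j x) (Lp.toTemperedDistribution S (𝓕 ψ)) := by
      have e : (fun j => ∫ x, 𝓕 ψ x * h j x) =
          fun j => Lp.toTemperedDistribution (H j) (𝓕 ψ) := by
        ext j
        rw [hrep]
        refine integral_congr_ae ?_
        filter_upwards [(hh j).coeFn_toLp] with x hx
        rw [hx]
      rw [e]
      exact h1
    change 𝓕 T ψ - Lp.toTemperedDistribution S (𝓕 ψ) = 0
    rw [(hT ψ hψ).unique h2, sub_self]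
  have hTS' : T = Lp.toTemperedDistribution S := by
    have := congrArg (fun R => 𝓕⁻ R) (sub_eq_zero.1 hTS)
    simpa using this
  have hR : IsRepresentedBy p T S := ⟨Lp.memLp S, fun ψ => by rw [hTS', hrep]⟩
  calc _ ≤ eLpNorm S p volume := iInf₂_le (S : Rn n → ℂ) hR
    _ = ‖S‖ₑ := (Lp.enorm_def S).symm
    _ ≤ ∑' j, ‖H j‖ₑ := enorm_tsum_le_tsum_enorm
    _ = _ := by simp_rw [hH]

end Reconstruction

end MGT

namespace MGT

/-! ### Decay of each component. -/

section Decay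

open MeasureTheory
open scoped Topology FourierTransform

lemma besovNorm_one {n : ℕ} (P : DyadicPartition n) (s : ℝ) (p : ℝ≥0∞) (f : 𝓢'(Rn n, ℂ)) :
    besovNorm P s p 1 f =
      ∑' j : ℤ, ENNReal.ofReal ((2 : ℝ) ^ ((j : ℝ) * s)) * lpNorm p (block P j f) := by
  simp [besovNorm]

lemma besovNorm_top {n : ℕ} (P : DyadicPartition n) (s : ℝ) (p : ℝ≥0∞) (f : 𝓢'(Rn n, ℂ)) :
    besovNorm P s p ∞ f =
      ⨆ j : ℤ, ENNReal.ofReal ((2 : ℝ) ^ ((j : ℝ) * s)) * lpNorm p (block P j f) :=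
  if_pos rfl

lemma lpNorm_block_ne_top {n : ℕ} {P : DyadicPartition n} {s : ℝ} {p : ℝ≥0∞} {f : 𝓢'(Rn n, ℂ)}
    (hf : besovNorm P s p 1 f < ∞) (j : ℤ) : lpNorm p (block P j f) ≠ ∞ := by
  rw [besovNorm_one] at hf
  intro h
  have h1 := ENNReal.ne_top_of_tsum_ne_top hf.ne j
  rw [h, ENNReal.mul_top] at h1
  · exact h1 rfl
  · rw [Ne, ENNReal.ofReal_eq_zero, not_le]
    positivity

/-- The propagator acts pointwise in frequency, so it preserves the annulus, and there its bound is
at worst the one at the lowest rate. -/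
lemma exp_mulVec_block_bound {n : ℕ} {τ κ C c : ℝ} (hC : 0 < C) (hc : 0 < c)
    (hprop : ∀ (η : Fin n → ℝ) (v : Unit ⊕ Fin n ⊕ Fin n → ℂ) (t : ℝ), 0 ≤ t → ∀ i,
      ‖(NormedSpace.exp ((t : ℂ) • symbol τ κ η)).mulVec v i‖ ≤
        C * Real.exp (-(c * ((∑ k, η k ^ 2) / (1 + ∑ k, η k ^ 2))) * t) * ∑ i, ‖v i‖)
    {G : Unit ⊕ Fin n ⊕ Fin n → Rn n → ℂ} {j : ℤ} (hGm : ∀ k, StronglyMeasurable (G k))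
    (hGs : ∀ k ξ, G k ξ ≠ 0 → ξ ∈ annulus n j) (hG : ∀ k, eLpNorm (G k) 2 volume ≠ ∞)
    {t : ℝ} (ht : 0 ≤ t) (i : Unit ⊕ Fin n ⊕ Fin n) {Y : Rn n → ℂ}
    (hY : Y = fun ξ => (NormedSpace.exp ((t : ℂ) • freqSymbol τ κ ξ)).mulVec (fun k => G k ξ) i) :
    MemLp Y 2 volume ∧ (∀ ξ, Y ξ ≠ 0 → ‖ξ‖ ≤ (2 : ℝ) ^ j) ∧
      eLpNorm Y 2 volume ≤ ENNReal.ofReal (C * Real.exp (-(c * ((4 : ℝ) ^ j / (2 + 4 ^ j))) * t)) *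
        ∑ k, eLpNorm (G k) 2 volume := by
  have hzero : ∀ ξ, ξ ∉ annulus n j → Y ξ = 0 := by
    intro ξ hξ
    have h1 : (fun k => G k ξ) = 0 := funext fun k => by
      by_contra h
      exact hξ (hGs k ξ h)
    simp [hY, h1]
  have hA : Continuous (freqSymbol (n := n) τ κ) :=
    continuous_matrix fun i j => (hasTemperateGrowth_freqSymbol τ κ i j).1.continuous
  have hYm : AEStronglyMeasurable Y volume := by
    rw [hY]
    simp only [Matrix.mulVec, dotProduct]
    exact (Finset.stronglyMeasurable_fun_sum _ fun k _ =>
      (continuous_exp_smul hA t i k).stronglyMeasurable.mul (hGm k)).aestronglyMeasurable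
  have hbound : ∀ ξ, ‖Y ξ‖ ≤ C * Real.exp (-(c * ((4 : ℝ) ^ j / (2 + 4 ^ j))) * t) *
      ‖∑ k, ‖G k ξ‖‖ := by
    intro ξ
    by_cases hξ : ξ ∈ annulus n j
    · have h1 := hprop (fun k => 2 * Real.pi * ξ k) (fun k => G k ξ) t ht i
      have h2 := rate_le_of_mem_annulus hξ
      rw [Real.norm_of_nonneg (Finset.sum_nonneg fun _ _ => norm_nonneg _), hY]
      refine h1.trans ?_
      have h3 : Real.exp (-(c * ((∑ k, (2 * Real.pi * ξ k) ^ 2) /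
          (1 + ∑ k, (2 * Real.pi * ξ k) ^ 2))) * t) ≤
          Real.exp (-(c * ((4 : ℝ) ^ j / (2 + 4 ^ j))) * t) :=
        Real.exp_le_exp.2 (mul_le_mul_of_nonneg_right
          (neg_le_neg (mul_le_mul_of_nonneg_left h2 hc.le)) ht)
      exact mul_le_mul_of_nonneg_right (mul_le_mul_of_nonneg_left h3 hC.le)
        (Finset.sum_nonneg fun _ _ => norm_nonneg _)
    · rw [hzero ξ hξ, norm_zero]
      positivity
  have hle : eLpNorm Y 2 volume ≤
      ENNReal.ofReal (C * Real.exp (-(c * ((4 : ℝ) ^ j / (2 + 4 ^ j))) * t)) *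
        ∑ k, eLpNorm (G k) 2 volume := by
    refine (eLpNorm_le_mul_eLpNorm_of_ae_le_mul (Filter.Eventually.of_forall hbound) 2).trans ?_
    gcongr
    have h1 := eLpNorm_sum_le (μ := (volume : Measure (Rn n))) (p := 2) (s := Finset.univ)
      (f := fun k ξ => ‖G k ξ‖) (fun k _ => (hGm k).norm.aestronglyMeasurable) (by norm_num)
    simp only [eLpNorm_norm] at h1
    refine le_trans (le_of_eq ?_) h1
    congr 1
    ext ξ
    simp
  refine ⟨⟨hYm, hle.trans_lt (ENNReal.mul_lt_top ENNReal.ofReal_lt_top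
    (ENNReal.sum_lt_top.2 fun k _ => (hG k).lt_top))⟩, fun ξ hξ => ?_, hle⟩
  refine norm_le_of_mem_annulus (n := n) ?_
  by_contra h
  exact hξ (hzero ξ h)

lemma lpNorm_component_decay {n : ℕ} (P : DyadicPartition n) {τ β p σ : ℝ} (hτ : 0 < τ)
    (hβ : τ < β) (hp : 2 ≤ p) (hσ : 0 < n * (1 / 2 - 1 / p) + σ) :
    ∃ C : ℝ, 0 < C ∧
      ∀ (u₀ u₁ u₂ : 𝓢'(Rn n, ℂ)) (u ut utt : ℝ → 𝓢'(Rn n, ℂ)),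
        IsSolution τ β u₀ u₁ u₂ u ut utt →
        (∀ i, MemBesov P (n * (1 / 2 - 1 / p)) 2 1 (vec τ u₀ u₁ u₂ i)) →
        (∀ i, besovNorm P (-σ) 2 ∞ (vec τ u₀ u₁ u₂ i) < ∞) →
        ∀ t : ℝ, 0 ≤ t → ∀ i,
          lpNorm (ENNReal.ofReal p) (vec τ (u t) (ut t) (utt t) i) ≤
            ENNReal.ofReal (C * (1 + t) ^ (-((n * (1 / 2 - 1 / p) + σ) / 2))) *
              (vecBesovNorm P (n * (1 / 2 - 1 / p)) 2 1 (vec τ u₀ u₁ u₂) +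
                vecBesovNorm P (-σ) 2 ∞ (vec τ u₀ u₁ u₂)) := by
  set s : ℝ := n * (1 / 2 - 1 / p) with hs
  have hp0 : 0 < p := by linarith
  have hp1 : 1 ≤ ENNReal.ofReal p := by
    rw [← ENNReal.ofReal_one]
    exact ENNReal.ofReal_le_ofReal (by linarith)
  have he : 0 ≤ 1 / 2 - 1 / p := sub_nonneg.2 (one_div_le_one_div_of_le (by norm_num) hp)
  obtain ⟨C₁, c, hC₁, hc, hprop⟩ := propagator_decay hτ (sub_pos.2 hβ)
  obtain ⟨C₂, hC₂, htime⟩ := tsum_weighted_decay_le hc hσ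
  set K : ℝ≥0∞ := volume (Metric.ball (0 : Rn n) 1) ^ (1 / 2 - 1 / p) with hK
  have hKtop : K ≠ ∞ := ENNReal.rpow_ne_top_of_nonneg he measure_ball_lt_top.ne
  have hball : ∀ j : ℤ, volume (Metric.closedBall (0 : Rn n) ((2 : ℝ) ^ j)) ^ (1 / 2 - 1 / p) =
      ENNReal.ofReal ((2 : ℝ) ^ ((j : ℝ) * s)) * K := fun j => volume_closedBall_rpow j he
  -- The three factors come from Bernstein (unit ball volume), the propagator and the dyadic sum;
  -- the `+ 1` makes positivity immediate.
  refine ⟨(K.toReal + 1) * C₁ * C₂, by positivity, ?_⟩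
  intro u₀ u₁ u₂ u ut utt hu h1 h2 t ht i
  set V := vec τ u₀ u₁ u₂ with hV
  have hex := fun k j => exists_fourier_block P j (V k) (lpNorm_block_ne_top (h1 k).2 j)
  choose G hGm hGs hGn hGF using hex
  have hGfin : ∀ k j, eLpNorm (G k j) 2 volume ≠ ∞ := fun k j => by
    rw [hGn]
    exact lpNorm_block_ne_top (h1 k).2 j
  have hGball : ∀ k j ξ, G k j ξ ≠ 0 → ‖ξ‖ ≤ (2 : ℝ) ^ j := fun k j ξ hξ =>
    norm_le_of_mem_annulus (hGs k j ξ hξ)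
  have hdec : ∀ k (χ : 𝓢(Rn n, ℂ)), HasSum (fun j => ∫ ξ, χ ξ * G k j ξ) (𝓕 (V k) χ) := by
    intro k χ
    have h3 := (h1 k).1.mapL (PointwiseConvergenceCLM.evalCLM (RingHom.id ℂ) ℂ (𝓕 χ))
    simp_rw [← hGF]
    exact h3
  have hlint : ∀ (ψ : 𝓢(Rn n, ℂ)) k, ∑' j, ∫⁻ ξ, ‖ψ ξ * G k j ξ‖ₑ ≤
      eLpNorm ψ (ENNReal.ofReal p) volume * (K * besovNorm P s 2 1 (V k)) := by
    intro ψ k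
    rw [besovNorm_one, ← ENNReal.tsum_mul_left, ← ENNReal.tsum_mul_left]
    refine ENNReal.tsum_le_tsum fun j => ?_
    refine (lintegral_mul_le_of_support hp (hGm k j).aestronglyMeasurable (hGball k j) ψ).trans ?_
    rw [hball, hGn]
    exact le_of_eq (by ring)
  have hlint_top : ∀ (ψ : 𝓢(Rn n, ℂ)) k, ∑' j, ∫⁻ ξ, ‖ψ ξ * G k j ξ‖ₑ ≠ ∞ := fun ψ k =>
    ((hlint ψ k).trans_lt (ENNReal.mul_lt_top (ψ.memLp _ _).2
      (ENNReal.mul_lt_top hKtop.lt_top (h1 k).2))).ne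
  have hmeas : ∀ (ψ : 𝓢(Rn n, ℂ)) k j, AEStronglyMeasurable (fun ξ => ψ ξ * G k j ξ) volume :=
    fun ψ k j => ψ.continuous.aestronglyMeasurable.mul (hGm k j).aestronglyMeasurable
  let Y : ℤ → Rn n → ℂ := fun j ξ =>
    (NormedSpace.exp ((t : ℂ) • freqSymbol τ (β - τ) ξ)).mulVec (fun k => G k j ξ) i
  have hYj := fun j => exp_mulVec_block_bound hC₁ hc (hprop n) (fun k => hGm k j)
    (fun k => hGs k j) (fun k => hGfin k j) ht i (Y := Y j) rfl
  have hex := fun j => exists_fourierInv_of_support hp (hYj j).1 (hYj j).2.1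
  choose h hhp hhF hhn using hex
  have hsumY : ∀ ψ : 𝓢(Rn n, ℂ), HasCompactSupport ψ → HasSum (fun j => ∫ x, 𝓕 ψ x * h j x)
      (𝓕 (vec τ (u t) (ut t) (utt t) i) ψ) := by
    intro ψ hψ
    simp_rw [hhF]
    have hevol := hasSum_evolution (hasTemperateGrowth_freqSymbol τ (β - τ))
      (fun t i => 𝓕 (vec τ (u t) (ut t) (utt t) i))
      (fun t ht i ψ => hasDerivWithinAt_fourier_vec hτ.ne' hu t ht i ψ) ψ hψ i t ht
    simp only [hu.init_u, hu.init_ut, hu.init_utt] at hevol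
    refine hasSum_integral_exp_mulVec (hasTemperateGrowth_freqSymbol τ (β - τ))
      (T := fun k χ => 𝓕 (V k) χ) hdec hψ (fun k j => ⟨hmeas ψ k j,
        (ENNReal.ne_top_of_tsum_ne_top (hlint_top ψ k) j).lt_top⟩) (fun k => ?_) t i hevol
    refine (ENNReal.summable_toReal (hlint_top ψ k)).congr fun j => ?_
    exact (integral_norm_eq_lintegral_enorm (hmeas ψ k j)).symm
  have hbound : ∑' j, eLpNorm (h j) (ENNReal.ofReal p) volume ≤
      ENNReal.ofReal ((K.toReal + 1) * C₁ * C₂ * (1 + t) ^ (-((s + σ) / 2))) *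
        (vecBesovNorm P s 2 1 V + vecBesovNorm P (-σ) 2 ∞ V) := by
    have hstep : ∀ j, eLpNorm (h j) (ENNReal.ofReal p) volume ≤ K * ENNReal.ofReal C₁ *
        ∑ k, ENNReal.ofReal ((2 : ℝ) ^ ((j : ℝ) * s)) *
          (ENNReal.ofReal (Real.exp (-(c * ((4 : ℝ) ^ j / (2 + 4 ^ j))) * t)) *
            lpNorm 2 (block P j (V k))) := by
      intro j
      refine (hhn j).trans ?_
      rw [hball]
      refine (mul_le_mul_right (hYj j).2.2 _).trans (le_of_eq ?_)
      rw [ENNReal.ofReal_mul hC₁.le]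
      simp_rw [hGn]
      rw [← Finset.mul_sum, ← Finset.mul_sum]
      ring
    have hKle : K ≤ ENNReal.ofReal (K.toReal + 1) := by
      rw [← ENNReal.ofReal_toReal hKtop]
      exact ENNReal.ofReal_le_ofReal (by simp)
    have hpos : 0 ≤ (1 + t) ^ (-((s + σ) / 2)) := Real.rpow_nonneg (by linarith) _
    calc _ ≤ ∑' j : ℤ, K * ENNReal.ofReal C₁ * ∑ k, ENNReal.ofReal ((2 : ℝ) ^ ((j : ℝ) * s)) *
          (ENNReal.ofReal (Real.exp (-(c * ((4 : ℝ) ^ j / (2 + 4 ^ j))) * t)) *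
            lpNorm 2 (block P j (V k))) := ENNReal.tsum_le_tsum hstep
      _ = K * ENNReal.ofReal C₁ * ∑ k, ∑' j : ℤ, ENNReal.ofReal ((2 : ℝ) ^ ((j : ℝ) * s)) *
          (ENNReal.ofReal (Real.exp (-(c * ((4 : ℝ) ^ j / (2 + 4 ^ j))) * t)) *
            lpNorm 2 (block P j (V k))) := by
          rw [ENNReal.tsum_mul_left, Summable.tsum_finsetSum fun _ _ => ENNReal.summable]
      _ ≤ ENNReal.ofReal (K.toReal + 1) * ENNReal.ofReal C₁ *
          ∑ k, ENNReal.ofReal (C₂ * (1 + t) ^ (-((s + σ) / 2))) *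
            (besovNorm P s 2 1 (V k) + besovNorm P (-σ) 2 ∞ (V k)) := by
          gcongr with k
          rw [besovNorm_one, besovNorm_top]
          exact htime (fun j => lpNorm 2 (block P j (V k))) t ht
      _ = _ := by
          rw [← Finset.mul_sum, Finset.sum_add_distrib, ← mul_assoc, ← ENNReal.ofReal_mul
            (by positivity), ← ENNReal.ofReal_mul (by positivity)]
          rw [mul_assoc _ C₂]
          rfl
  refine (lpNorm_le_tsum hp1 hhp (hbound.trans_lt ?_).ne hsumY).trans hbound
  exact ENNReal.mul_lt_top ENNReal.ofReal_lt_top (ENNReal.add_lt_top.2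
    ⟨ENNReal.sum_lt_top.2 fun k _ => (h1 k).2, ENNReal.sum_lt_top.2 fun k _ => h2 k⟩)

end Decay

end MGT

end

theorem corollary5p2 (n : ℕ) (hn : 1 ≤ n) (P : MGT.DyadicPartition n)
    (τ β : ℝ) (hτ : 0 < τ) (hβ : τ < β)
    (p q : ℝ) (hp : 2 ≤ p) (hq : 1 ≤ q) (hqp : q < p) :
    ∃ C : ℝ, 0 < C ∧
      ∀ (u₀ u₁ u₂ : 𝓢'(MGT.Rn n, ℂ)) (u ut utt : ℝ → 𝓢'(MGT.Rn n, ℂ)),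
        MGT.IsSolution τ β u₀ u₁ u₂ u ut utt →
        (∀ i, MGT.MemBesov P (n * (1 / 2 - 1 / p)) 2 1 (MGT.vec τ u₀ u₁ u₂ i)) →
        (∀ i, MGT.MemBesov P (-(n * (1 / q - 1 / 2))) 2 ∞ (MGT.vec τ u₀ u₁ u₂ i)) →
        ∀ t : ℝ, 0 ≤ t →
          MGT.vecLpNorm (ENNReal.ofReal p) (MGT.vec τ (u t) (ut t) (utt t)) ≤
            ENNReal.ofReal (C * (1 + t) ^ (-((n : ℝ) / 2 * (1 / q - 1 / p)))) *
              (MGT.vecBesovNorm P (n * (1 / 2 - 1 / p)) 2 1 (MGT.vec τ u₀ u₁ u₂) +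
                MGT.vecBesovNorm P (-(n * (1 / q - 1 / 2))) 2 ∞ (MGT.vec τ u₀ u₁ u₂)) := by
  have hn' : (0 : ℝ) < n := by exact_mod_cast hn
  have hlt : 0 < 1 / q - 1 / p := sub_pos.2 (one_div_lt_one_div_of_lt (by linarith) hqp)
  have hσ : (n : ℝ) * (1 / 2 - 1 / p) + n * (1 / q - 1 / 2) = n * (1 / q - 1 / p) := by ring
  obtain ⟨C, hC, h⟩ := MGT.lpNorm_component_decay P hτ hβ hp
    (σ := n * (1 / q - 1 / 2)) (by rw [hσ]; positivity)
  -- The vector norm is a sum over components, each bounded by the norms of the whole initial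
  -- vector.
  refine ⟨Fintype.card (Unit ⊕ Fin n ⊕ Fin n) * C, by positivity, ?_⟩
  intro u₀ u₁ u₂ u ut utt hu h1 h2 t ht
  have h3 := h u₀ u₁ u₂ u ut utt hu h1 (fun i => (h2 i).2) t ht
  have e : ((n : ℝ) * (1 / 2 - 1 / p) + n * (1 / q - 1 / 2)) / 2 = n / 2 * (1 / q - 1 / p) := by
    ring
  rw [e] at h3
  refine (Finset.sum_le_sum fun i _ => h3 i).trans (le_of_eq ?_)
  rw [Finset.sum_const, Finset.card_univ, nsmul_eq_mul, mul_assoc (Fintype.card _ : ℝ),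
    ENNReal.ofReal_mul (Nat.cast_nonneg _), ENNReal.ofReal_natCast, mul_assoc]
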